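/- **Model.** For each $n$ let $V=\{1,\dots,n\}$, let $K\subseteq V$ be a target cluster with $|K|=k$, let $p,q\in[0,1]$, and let $G$ be a random graph on $V$ in which each pair inside $K$ is an edge with probability $p$ and each pair with exactly one node in $K$ is an edge with probability $q$; the edges among $V\setminus K$ follow an arbitrary law. Node $i$ carries the attribute $X_i=\mu_i+Z_i\in\mathbb R^d$, where the $\mu_i$ are deterministic, $\mu_i=\mu_j$ for $i,j\in K$, and the coordinates $Z_{i\ell}$ have mean zero and satisfy $\mathbb P(|Z_{i\ell}|\ge t)\le 2\exp(-t^2/(2\sigma_\ell^2))$ for all $t\ge 0$, with $\sigma_\ell>0$. All edge indicators of pairs touching $K$ and all $Z_{i\ell}$ are mutually independent. All of $K,p,q,d,\mu_i,\sigma_\ell$ may depend on $n$. Put $\hat\mu=\min_{i\in K,\,j\notin K}\|\mu_i-\mu_j\|_2$ and $\hat\sigma=\max_\ell\sigma_\ell$. **Flow diffusion.** Give each edge $(i,j)$ of $G$ the weight $w_{ij}=\exp(-\gamma\|X_i-X_j\|_2^2)$, $\gamma\ge 0$, and let $L$ be the weighted Laplacian. For sink capacities $T\in\mathbb R^V$,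 a seed $s\in K$ and $\beta>0$, let $\Delta_s=(1+\beta)\sum_{i\in K}T_i$ and $\Delta_i=0$ for $i\ne s$. Write $x^*$ for any optimal solution of $\min_{x\ge 0}\tfrac12x^{\top}Lx+x^{\top}(T-\Delta)$. **Assumptions.** Let $\lambda,\gamma,\beta$ be sequences in $n$ with $\beta>0$, $\gamma\ge0$, $\lambda=\Omega(1)$, $\hat\mu=\omega(\hat\sigma\sqrt{\lambda\log n})$, $\sum_{\ell=1}^d\sigma_\ell^2/\hat\sigma^2=O(\log n)$, $\gamma\hat\sigma^2=o(1/\log n)$ and $\gamma\hat\mu^2=\omega(\lambda)$. Write $\log^+ t=\max(0,\log t)$ for $t>0$ and $\log^+0=0$. **Theorem.** Call an outcome *good* if the following holds simultaneously for every seed $s\in K$. For every $T$ with $T_i\ge 1$ for all $i$, every optimal solution $x^*$ satisfies $$K\subseteq\mathrm{supp}(x^*)\quad\text{and}\quad\sum_{i\in\mathrm{supp}(x^*)\setminus K}T_i\le\beta\sum_{i\in K}T_i .$$ In particular, for $T_i=1$ for all $i$, $K\subseteq\mathrm{supp}(x^*)$ and $|\mathrm{supp}(x^*)\setminus K|\le\beta|K|$.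 Moreover, for $T_i=\deg_G(i)$ for all $i$, $K\subseteq\mathrm{supp}(x^*)$ and $\mathrm{vol}_G(\mathrm{supp}(x^*)\setminus K)\le\beta\,\mathrm{vol}_G(K)$, where $\mathrm{vol}_G(C)=\sum_{i\in C}\deg_G(i)$. 1. If $\lambda=\Omega\big(\log k+\log^+(1/\beta)+\log^+(q(n-k))\big)$, then, conditionally on $K$ being connected (that is, the subgraph of $G$ induced on $K$ is connected), the outcome is good with probability at least $1-o(1)-k^{-1/3}$. 2. Let $0<\delta<1$ and $\epsilon>0$ (both may depend on $n$). If, for all large $n$, $p\ge\frac{4+\epsilon}{\delta^2}\frac{\log k}{k-1}$ (no condition when $k=1$), and $$\lambda=\Omega\Big(\log k+\log^+(1/\beta)+\log^+\tfrac{q(n-k)}{p(k-1)}+\log\tfrac1{1-\delta}\Big)$$ (the third term being read as $0$ when $k=1$), then the outcome is good with probability at least $1-o(1)-k^{-1/3}-e\,k^{-\epsilon/2}$. -/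

import Mathlib

open MeasureTheory ProbabilityTheory Filter Topology Asymptotics
open scoped Matrix

noncomputable section

/-! ### Weighted graphs and flow diffusion -/

section Flow

variable {V : Type*} [Fintype V] [DecidableEq V]

/-- The Laplacian `D - A_w` of the graph with symmetric weight matrix `w`
(`w i j = 0` when `i` and `j` are not adjacent), `D` being the diagonal matrix of weighted degrees.
It equals `Bᵀ W B` for any signed incidence matrix `B`. -/
def weightedLaplacian (w : Matrix V V ℝ) : Matrix V V ℝ :=
  Matrix.diagonal (fun i => ∑ j, w i j) - w

/-- The quadratic form of the weighted Laplacian is `∑ over edges of w_{ij} (x_i - x_j)^2`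
(each edge appears twice in the double sum). -/
theorem weightedLaplacian_quadraticForm (w : Matrix V V ℝ) (hw : ∀ i j, w i j = w j i)
    (x : V → ℝ) :
    x ⬝ᵥ (weightedLaplacian w *ᵥ x) = (1 / 2) * ∑ i, ∑ j, w i j * (x i - x j) ^ 2 := by
  have h1 : x ⬝ᵥ (weightedLaplacian w *ᵥ x)
      = (∑ i, ∑ j, w i j * x i ^ 2) - ∑ i, ∑ j, w i j * (x i * x j) := by
    rw [weightedLaplacian, Matrix.sub_mulVec, dotProduct_sub]
    congr 1
    · simp only [dotProduct, Matrix.mulVec_diagonal]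
      refine Finset.sum_congr rfl fun i _ => ?_
      rw [Finset.sum_mul, Finset.mul_sum]
      exact Finset.sum_congr rfl fun j _ => by ring
    · simp only [dotProduct, Matrix.mulVec]
      refine Finset.sum_congr rfl fun i _ => ?_
      rw [Finset.mul_sum]
      exact Finset.sum_congr rfl fun j _ => by ring
  have h2 : ∑ i, ∑ j, w i j * x j ^ 2 = ∑ i, ∑ j, w i j * x i ^ 2 := by
    rw [Finset.sum_comm]
    exact Finset.sum_congr rfl fun i _ => Finset.sum_congr rfl fun j _ => by rw [hw]
  have h3 : ∑ i, ∑ j, w i j * (x i - x j) ^ 2 = (∑ i, ∑ j, w i j * x i ^ 2)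
      + (∑ i, ∑ j, w i j * x j ^ 2) - 2 * ∑ i, ∑ j, w i j * (x i * x j) := by
    simp only [Finset.mul_sum, ← Finset.sum_add_distrib, ← Finset.sum_sub_distrib]
    exact Finset.sum_congr rfl fun i _ => Finset.sum_congr rfl fun j _ => by ring
  rw [h1, h3, h2]
  ring

/-- The dual objective of flow diffusion: `½ xᵀ L x + xᵀ (T - Δ)`. -/
def dualObjective (w : Matrix V V ℝ) (Δ T x : V → ℝ) : ℝ :=
  (1 / 2) * (x ⬝ᵥ (weightedLaplacian w *ᵥ x)) + x ⬝ᵥ (T - Δ)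

/-- `x` is an optimal solution of the dual problem `min_{x ≥ 0} ½ xᵀ L x + xᵀ (T - Δ)`. -/
def IsDualOptimal (w : Matrix V V ℝ) (Δ T x : V → ℝ) : Prop :=
  (∀ i, 0 ≤ x i) ∧
    ∀ y : V → ℝ, (∀ i, 0 ≤ y i) → dualObjective w Δ T x ≤ dualObjective w Δ T y

open Classical in
/-- The support of a vector. -/
def vecSupport (x : V → ℝ) : Finset V := Finset.univ.filter (fun i => x i ≠ 0)

/-- The source vector with all of its mass `(1 + β) ∑_{i ∈ K} T_i` at the seed `s`. -/
def seedSource (K : Finset V) (β : ℝ) (T : V → ℝ) (s : V) : V → ℝ :=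
  Pi.single s ((1 + β) * ∑ i ∈ K, T i)

open Classical in
/-- The combinatorial degree of a node. -/
def nodeDegree (G : SimpleGraph V) (i : V) : ℕ := G.degree i

/-- The volume `vol_G(C)`. -/
def graphVolume (G : SimpleGraph V) (C : Finset V) : ℕ := ∑ i ∈ C, nodeDegree G i

end Flow

/-! ### The contextual local random model -/

/-- Unordered pairs of distinct nodes (listed increasingly) with at least one end in `K`. -/
abbrev ClusterPair {n : ℕ} (K : Finset (Fin n)) : Type :=
  {e : Fin n × Fin n // e.1 < e.2 ∧ (e.1 ∈ K ∨ e.2 ∈ K)}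

/-- The contextual local random model on `n` nodes over the probability space `(Ω, P)`. -/
structure ContextualLocalModel (n : ℕ) {Ω : Type*} [MeasurableSpace Ω] (P : Measure Ω) where
  /-- the target cluster -/
  K : Finset (Fin n)
  /-- probability of an edge inside `K` -/
  p : ℝ
  /-- probability of an edge between `K` and its complement -/
  q : ℝ
  p_mem : p ∈ Set.Icc (0 : ℝ) 1
  q_mem : q ∈ Set.Icc (0 : ℝ) 1
  /-- dimension of the node attributes -/
  d : ℕ
  /-- the signal vectors -/
  mu : Fin n → EuclideanSpace ℝ (Fin d)
  mu_eq : ∀ i ∈ K, ∀ j ∈ K, mu i = mu j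
  /-- the coordinate-wise noise levels -/
  sigma : Fin d → ℝ
  sigma_pos : ∀ l, 0 < sigma l
  /-- the random graph; its edges outside `K` follow an arbitrary law -/
  graph : Ω → SimpleGraph (Fin n)
  /-- the coordinates `Z_{il}` of the noise vectors -/
  Z : Fin n → Fin d → Ω → ℝ
  measurableSet_adj : ∀ i j, MeasurableSet {ω | (graph ω).Adj i j}
  measurable_Z : ∀ i l, Measurable (Z i l)
  prob_inside : ∀ i ∈ K, ∀ j ∈ K, i ≠ j → P.real {ω | (graph ω).Adj i j} = p
  prob_across : ∀ i ∈ K, ∀ j ∉ K, P.real {ω | (graph ω).Adj i j} = q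
  mean_zero : ∀ i l, ∫ ω, Z i l ω ∂P = 0
  subGaussian : ∀ i l, ∀ t : ℝ, 0 ≤ t →
    P.real {ω | t ≤ |Z i l ω|} ≤ 2 * Real.exp (-(t ^ 2 / (2 * sigma l ^ 2)))
  /-- the edges that touch `K` and the noise coordinates are mutually independent -/
  independent : iIndepFun (β := fun _ : ClusterPair K ⊕ (Fin n × Fin d) => ℝ)
    (Sum.elim
      (fun (e : ClusterPair K) (ω : Ω) =>
        Set.indicator {ω' | (graph ω').Adj e.1.1 e.1.2} (fun _ => (1 : ℝ)) ω)
      (fun (c : Fin n × Fin d) (ω : Ω) => Z c.1 c.2 ω)) P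

namespace ContextualLocalModel

variable {n : ℕ} {Ω : Type*} [MeasurableSpace Ω] {P : Measure Ω}

/-- The cluster size `k = |K|`, as a real number. -/
def k (M : ContextualLocalModel n P) : ℝ := (M.K.card : ℝ)

/-- The node attributes `X_i = μ_i + Z_i`. -/
def X (M : ContextualLocalModel n P) (i : Fin n) (ω : Ω) : EuclideanSpace ℝ (Fin M.d) :=
  M.mu i + WithLp.toLp 2 (fun l => M.Z i l ω)

/-- `μ̂`: the smallest distance between the signal of a node in `K` and that of a node outside. -/
def muHat (M : ContextualLocalModel n P) : ℝ :=
  ⨅ e : {e : Fin n × Fin n // e.1 ∈ M.K ∧ e.2 ∉ M.K}, ‖M.mu e.1.1 - M.mu e.1.2‖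

/-- `σ̂`: the largest coordinate-wise noise level. -/
def sigmaHat (M : ContextualLocalModel n P) : ℝ := ⨆ l, M.sigma l

open Classical in
/-- Weights of the reweighted graph: `exp (-γ ‖X_i - X_j‖²)` on the edges, `0` elsewhere. -/
def weights (M : ContextualLocalModel n P) (γ : ℝ) (ω : Ω) : Matrix (Fin n) (Fin n) ℝ :=
  fun i j => if (M.graph ω).Adj i j then Real.exp (-γ * ‖M.X i ω - M.X j ω‖ ^ 2) else 0

/-- The subgraph induced on the target cluster is connected. -/
def ClusterConnected (M : ContextualLocalModel n P) (ω : Ω) : Prop :=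
  ((M.graph ω).induce (M.K : Set (Fin n))).Connected

/-- The recovery guarantee at the outcome `ω`: for every seed `s ∈ K` and every optimal solution
`x` of the flow diffusion started with mass `(1 + β) ∑_{i ∈ K} T_i` at `s`, for all capacities
`T ≥ 1`; with its instances `T = 1` (number of false positives) and `T = deg_G` (volume of false
positives; here isolated nodes, which have capacity `0`, are allowed). -/
def Recovers (M : ContextualLocalModel n P) (γ β : ℝ) (ω : Ω) : Prop :=
  ∀ s ∈ M.K,
    (∀ T : Fin n → ℝ, (∀ i, 1 ≤ T i) → ∀ x : Fin n → ℝ,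
      IsDualOptimal (M.weights γ ω) (seedSource M.K β T s) T x →
        M.K ⊆ vecSupport x ∧ ∑ i ∈ vecSupport x \ M.K, T i ≤ β * ∑ i ∈ M.K, T i) ∧
    (∀ x : Fin n → ℝ,
      IsDualOptimal (M.weights γ ω) (seedSource M.K β (fun _ => 1) s) (fun _ => 1) x →
        M.K ⊆ vecSupport x ∧ ((vecSupport x \ M.K).card : ℝ) ≤ β * (M.K.card : ℝ)) ∧
    (∀ x : Fin n → ℝ,
      IsDualOptimal (M.weights γ ω)
        (seedSource M.K β (fun i => (nodeDegree (M.graph ω) i : ℝ)) s)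
        (fun i => (nodeDegree (M.graph ω) i : ℝ)) x →
        M.K ⊆ vecSupport x ∧
          (graphVolume (M.graph ω) (vecSupport x \ M.K) : ℝ)
            ≤ β * (graphVolume (M.graph ω) M.K : ℝ))

end ContextualLocalModel

/-- `f = Ω_n(g)`: eventually `f n ≥ c * g n`, for some constant `c > 0`. -/
def IsBigOmega (f g : ℕ → ℝ) : Prop := ∃ c : ℝ, 0 < c ∧ ∀ᶠ n in atTop, c * g n ≤ f n

/-- The signal-to-noise assumption, for a sequence of models and a given sequence `λ`:
`λ = Ω(1)`, `μ̂ = ω(σ̂ √(λ log n))` and `∑_l σ_l² / σ̂² = O(log n)`. -/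
def SignalAssumption {Ω : ℕ → Type*} [∀ n, MeasurableSpace (Ω n)] {P : ∀ n, Measure (Ω n)}
    (M : ∀ n, ContextualLocalModel n (P n)) (lam : ℕ → ℝ) : Prop :=
  IsBigOmega lam (fun _ => 1) ∧
  ((fun n => (M n).sigmaHat * Real.sqrt (lam n * Real.log n)) =o[atTop] fun n => (M n).muHat) ∧
  ((fun n => ∑ l, (M n).sigma l ^ 2 / (M n).sigmaHat ^ 2) =O[atTop] fun n => Real.log n)

end

/-! ### Optimality conditions of flow diffusion and the deterministic recovery criterion. -/

section FlowDiffusion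

variable {V : Type*} [Fintype V] [DecidableEq V]

/-! Read `x` as a potential and `w i j * (x i - x j)` as the flow from `i` to `j`. Optimality says
that the net outflow at `i` is at least `Δ i - T i`, with equality where `x i > 0`. No flow enters
the support, so its capacity is at most the source mass `(1 + β) T(K)`. Once `K` is covered,
subtracting `T(K)` leaves `β T(K)` for the false positives
(`IsDualOptimal.sum_vecSupport_sdiff_le`).

Coverage is by contradiction (`IsDualOptimal.subset_vecSupport`). No edge carries more than the
source mass, so along an edge of weight at least `c` the potential drops by at most `(1 + β) T(K) /
c`. If `K` is connected through such edges and `x` vanishes somewhere on `K`, then `x` is at most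
`k` such drops on `K`. The excess `β T(K)` must nevertheless leave `K`, which is impossible when the
boundary weight is too small.

Randomness enters in three ways. A Chernoff bound keeps all noise vectors in a ball of radius `ρ` of
order `σ̂ √(log n)`, so edges inside `K` have weight at least `1/2` and boundary edges at most `exp
(-γ μ̂² / 4)`. Markov's inequality bounds the number of boundary edges. Their weight is then
negligible: the logarithms of `k`, `1/β` and `q(n-k)` are `O(λ)`, while `λ = o(γ μ̂²)`. Noise and
boundary edges are independent of the edges inside `K`, so these bounds survive conditioning on
connectivity. For the second claim, a union bound over isolated subsets gives connectivity, and
`p(k-1) ≤ k` turns its condition on `λ` into that of the first claim.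

For `k ≥ 2` the term `k^(-1/3)` is not needed; it only makes the case `k = 1` trivial. -/

theorem weightedLaplacian_mulVec (w : Matrix V V ℝ) (x : V → ℝ) (i : V) :
    (weightedLaplacian w *ᵥ x) i = ∑ j, w i j * (x i - x j) := by
  rw [weightedLaplacian, Matrix.sub_mulVec, Pi.sub_apply, Matrix.mulVec_diagonal, Finset.sum_mul,
    Matrix.mulVec, dotProduct, ← Finset.sum_sub_distrib]
  exact Finset.sum_congr rfl fun j _ => by ring

/-- The net flow out of a set of nodes crosses its boundary. -/
theorem sum_weightedLaplacian_mulVec (w : Matrix V V ℝ) (hw : ∀ i j, w i j = w j i) (x : V → ℝ)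
    (U : Finset V) :
    ∑ i ∈ U, (weightedLaplacian w *ᵥ x) i = ∑ i ∈ U, ∑ j ∈ Uᶜ, w i j * (x i - x j) := by
  have h0 : ∑ i ∈ U, ∑ j ∈ U, w i j * (x i - x j) = 0 := by
    have h1 : ∑ i ∈ U, ∑ j ∈ U, w i j * (x i - x j)
        = -∑ i ∈ U, ∑ j ∈ U, w i j * (x i - x j) := by
      conv_lhs => rw [Finset.sum_comm]
      simp only [← Finset.sum_neg_distrib]
      refine Finset.sum_congr rfl fun i _ => Finset.sum_congr rfl fun j _ => ?_
      rw [hw j i]; ring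
    linarith
  simp only [weightedLaplacian_mulVec]
  simp only [← Finset.sum_add_sum_compl U, Finset.sum_add_distrib]
  rw [h0, zero_add]

theorem dualObjective_add_single (w : Matrix V V ℝ) (hw : ∀ i j, w i j = w j i)
    (Δ T x : V → ℝ) (i : V) (t : ℝ) :
    dualObjective w Δ T (x + Pi.single i t) = dualObjective w Δ T x
      + t * ((weightedLaplacian w *ᵥ x) i + T i - Δ i)
      + t ^ 2 / 2 * weightedLaplacian w i i := by
  have hs : (weightedLaplacian w)ᵀ = weightedLaplacian w := by
    ext a b
    simp only [weightedLaplacian, Matrix.transpose_apply, Matrix.sub_apply, hw b a]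
    rw [← Matrix.transpose_apply (Matrix.diagonal _), Matrix.diagonal_transpose]
  have h1 : x ⬝ᵥ (weightedLaplacian w *ᵥ Pi.single i t) = t * (weightedLaplacian w *ᵥ x) i := by
    rw [Matrix.dotProduct_mulVec, ← Matrix.mulVec_transpose, hs, dotProduct_single, mul_comm]
  unfold dualObjective
  rw [Matrix.mulVec_add, dotProduct_add, add_dotProduct, add_dotProduct, add_dotProduct, h1]
  simp only [single_dotProduct, Matrix.mulVec_single, Pi.sub_apply, Matrix.col_apply, Pi.smul_apply,
    MulOpposite.smul_eq_mul_unop, MulOpposite.unop_op]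
  ring

/-- Raising a single coordinate is always feasible, so no partial derivative is negative at the
optimum. -/
theorem IsDualOptimal.gradient_nonneg {w : Matrix V V ℝ} (hw : ∀ i j, w i j = w j i)
    {Δ T x : V → ℝ} (h : IsDualOptimal w Δ T x) (i : V) :
    Δ i - T i ≤ (weightedLaplacian w *ᵥ x) i := by
  by_contra! hlt
  set g := (weightedLaplacian w *ᵥ x) i + T i - Δ i with hg
  have hgneg : g < 0 := by linarith
  set c := weightedLaplacian w i i
  -- The objective changes by `t * (g + t * c / 2)`. This step length keeps `t * c` below `-g`, so
  -- the linear term wins; the `+ 1` avoids division by zero.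
  set t := -g / (|c| + 1) with ht
  have hc : 0 < |c| + 1 := by positivity
  have htpos : 0 < t := div_pos (by linarith) hc
  have h1 := h.2 (x + Pi.single i t) fun j => add_nonneg (h.1 j)
    (by rcases eq_or_ne j i with rfl | hj
        · simpa using htpos.le
        · simp [hj])
  rw [dualObjective_add_single w hw] at h1
  have h2 : t * (|c| + 1) = -g := by rw [ht]; field_simp
  have h3 : t * c ≤ t * |c| := mul_le_mul_of_nonneg_left (le_abs_self c) htpos.le
  have h4 : 0 ≤ t * (g + t * c / 2) := by rw [← hg] at h1; nlinarith
  have h5 := nonneg_of_mul_nonneg_right h4 htpos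
  nlinarith

/-- Complementary slackness: a positive coordinate can also be lowered, so its partial derivative
vanishes. -/
theorem IsDualOptimal.gradient_eq_zero {w : Matrix V V ℝ} (hw : ∀ i j, w i j = w j i)
    {Δ T x : V → ℝ} (h : IsDualOptimal w Δ T x) (i : V) (hi : 0 < x i) :
    (weightedLaplacian w *ᵥ x) i = Δ i - T i := by
  refine le_antisymm ?_ (h.gradient_nonneg hw i)
  by_contra! hlt
  set g := (weightedLaplacian w *ᵥ x) i + T i - Δ i with hg
  have hgpos : 0 < g := by linarith
  set c := weightedLaplacian w i i
  have hc : 0 < |c| + 1 := by positivity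
  set t := min (x i) (g / (|c| + 1)) with ht
  have htpos : 0 < t := lt_min hi (div_pos hgpos hc)
  have h1 := h.2 (x + Pi.single i (-t)) fun j => by
    rcases eq_or_ne j i with rfl | hj
    · have : t ≤ x j := min_le_left _ _
      simpa using this
    · simpa [hj] using h.1 j
  rw [dualObjective_add_single w hw] at h1
  have h2 : t * (|c| + 1) ≤ g := by
    rw [← le_div_iff₀ hc]; exact min_le_right _ _
  have h3 : t * c ≤ t * |c| := mul_le_mul_of_nonneg_left (le_abs_self c) htpos.le
  have h4 : 0 ≤ t * (-g + t * c / 2) := by rw [← hg] at h1; nlinarith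
  have h5 := nonneg_of_mul_nonneg_right h4 htpos
  nlinarith

/-- The mass absorbed by the support is at most the mass of the source. -/
theorem IsDualOptimal.sum_vecSupport_le {w : Matrix V V ℝ} (hw : ∀ i j, w i j = w j i)
    (hw0 : ∀ i j, 0 ≤ w i j) {Δ T x : V → ℝ} (h : IsDualOptimal w Δ T x) :
    ∑ i ∈ vecSupport x, T i ≤ ∑ i ∈ vecSupport x, Δ i := by
  have h1 : ∑ i ∈ vecSupport x, (weightedLaplacian w *ᵥ x) i
      = ∑ i ∈ vecSupport x, (Δ i - T i) := by
    refine Finset.sum_congr rfl fun i hi => h.gradient_eq_zero hw i ?_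
    exact lt_of_le_of_ne (h.1 i) (by simpa [vecSupport, eq_comm] using hi)
  rw [sum_weightedLaplacian_mulVec w hw, Finset.sum_sub_distrib] at h1
  have h2 : 0 ≤ ∑ i ∈ vecSupport x, ∑ j ∈ (vecSupport x)ᶜ, w i j * (x i - x j) := by
    refine Finset.sum_nonneg fun i _ => Finset.sum_nonneg fun j hj => ?_
    have hj0 : x j = 0 := by simpa [vecSupport] using hj
    rw [hj0, sub_zero]
    exact mul_nonneg (hw0 i j) (h.1 i)
  linarith

/-- No edge carries more flow than the total source mass. -/
theorem IsDualOptimal.edge_flow_le {w : Matrix V V ℝ} (hw : ∀ i j, w i j = w j i)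
    (hw0 : ∀ i j, 0 ≤ w i j) {Δ T x : V → ℝ} (hT : ∀ i, 0 ≤ T i) (hΔ : ∀ i, 0 ≤ Δ i)
    (h : IsDualOptimal w Δ T x) (u v : V) :
    w u v * (x u - x v) ≤ ∑ i, Δ i := by
  rcases le_or_gt (x u) (x v) with huv | huv
  · exact (mul_nonpos_of_nonneg_of_nonpos (hw0 u v) (by linarith)).trans
      (Finset.sum_nonneg fun i _ => hΔ i)
  -- Cut at the level of `u`: every edge leaving this superlevel set carries flow outwards, so one
  -- edge carries at most the net outflow of `U`. All potentials on `U` are positive, so that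
  -- outflow is exactly source minus sink.
  set U : Finset V := Finset.univ.filter fun i => x u ≤ x i with hU
  have hterm : ∀ i ∈ U, ∀ j ∈ Uᶜ, 0 ≤ w i j * (x i - x j) := by
    intro i hi j hj
    simp only [hU, Finset.mem_filter, Finset.mem_univ, true_and, Finset.mem_compl, not_le] at hi hj
    exact mul_nonneg (hw0 i j) (by linarith)
  calc w u v * (x u - x v) ≤ ∑ j ∈ Uᶜ, w u j * (x u - x j) :=
        Finset.single_le_sum (f := fun j => w u j * (x u - x j))
          (fun j hj => hterm u (by simp [hU]) j hj) (by simp [hU, huv])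
    _ ≤ ∑ i ∈ U, ∑ j ∈ Uᶜ, w i j * (x i - x j) :=
        Finset.single_le_sum (f := fun i => ∑ j ∈ Uᶜ, w i j * (x i - x j))
          (fun i hi => Finset.sum_nonneg (hterm i hi)) (by simp [hU])
    _ = ∑ i ∈ U, (weightedLaplacian w *ᵥ x) i := (sum_weightedLaplacian_mulVec w hw x U).symm
    _ ≤ ∑ i ∈ U, Δ i := by
        refine Finset.sum_le_sum fun i hi => ?_
        have hi' : x u ≤ x i := by simpa [hU] using hi
        rw [h.gradient_eq_zero hw i (by linarith [h.1 v])]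
        linarith [hT i]
    _ ≤ ∑ i, Δ i := Finset.sum_le_sum_of_subset_of_nonneg (Finset.subset_univ _) fun i _ _ => hΔ i

theorem SimpleGraph.Walk.sub_le_length_mul {W : Type*} {H : SimpleGraph W} {f : W → ℝ} {c : ℝ}
    (hf : ∀ a b, H.Adj a b → f a - f b ≤ c) {a b : W} (p : H.Walk a b) :
    f a - f b ≤ p.length * c := by
  induction p with
  | nil => simp
  | cons hab p ih =>
    have := hf _ _ hab
    rw [SimpleGraph.Walk.length_cons]
    push_cast
    linarith

omit [Fintype V] in
theorem seedSource_nonneg {K : Finset V} {β : ℝ} (hβ : 0 < β) {T : V → ℝ} (hT : ∀ i, 0 ≤ T i)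
    (s i : V) : 0 ≤ seedSource K β T s i := by
  have : 0 ≤ (1 + β) * ∑ i ∈ K, T i :=
    mul_nonneg (by linarith) (Finset.sum_nonneg fun i _ => hT i)
  rcases eq_or_ne i s with rfl | hi
  · simpa [seedSource] using this
  · simp [seedSource, hi]

omit [Fintype V] in
theorem sum_seedSource {K U : Finset V} {β : ℝ} {T : V → ℝ} {s : V} (hs : s ∈ U) :
    ∑ i ∈ U, seedSource K β T s i = (1 + β) * ∑ i ∈ K, T i := by
  rw [seedSource, Finset.sum_pi_single']
  simp [hs]

/-- If the cluster `K` is connected through edges of weight at least `c` and the total weight of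
its boundary is small, then flow diffusion covers `K`. -/
theorem IsDualOptimal.subset_vecSupport {w : Matrix V V ℝ} (hw : ∀ i j, w i j = w j i)
    (hw0 : ∀ i j, 0 ≤ w i j) {K : Finset V} {β c : ℝ} (hβ : 0 < β) (hc : 0 < c)
    {H : SimpleGraph V} (hH : (H.induce (K : Set V)).Connected)
    (hin : ∀ i ∈ K, ∀ j ∈ K, H.Adj i j → c ≤ w i j)
    (hcut : K.card * (1 + β) * ∑ i ∈ K, ∑ j ∈ Kᶜ, w i j < β * c)
    {T x : V → ℝ} (hT : ∀ i, 0 ≤ T i) (hTK : 0 < ∑ i ∈ K, T i) {s : V} (hs : s ∈ K)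
    (h : IsDualOptimal w (seedSource K β T s) T x) : K ⊆ vecSupport x := by
  intro i₀ hi₀
  by_contra hx
  have hx0 : x i₀ = 0 := by simpa [vecSupport] using hx
  set τ := ∑ i ∈ K, T i with hτ
  -- `B` is the largest potential drop along an edge of weight at least `c`.
  set B := (1 + β) * τ / c with hB
  have hB0 : 0 ≤ B := by positivity
  have hedge : ∀ a b : (K : Set V), (H.induce (K : Set V)).Adj a b → x a - x b ≤ B := by
    intro a b hab
    have h1 := h.edge_flow_le hw hw0 hT (seedSource_nonneg hβ hT s) a b
    rw [sum_seedSource (Finset.mem_univ s), ← hτ] at h1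
    rcases le_or_gt (x a - x b) 0 with h2 | h2
    · exact h2.trans hB0
    · rw [hB, le_div_iff₀ hc]
      have := hin a a.2 b b.2 hab
      nlinarith
  have hbound : ∀ i ∈ K, x i ≤ K.card * B := by
    intro i hi
    obtain ⟨p, hp⟩ := hH.exists_isPath ⟨i, hi⟩ ⟨i₀, hi₀⟩
    have h1 := p.sub_le_length_mul (f := fun a : (K : Set V) => x a) hedge
    have h2 : p.length ≤ K.card := by
      have := hp.length_lt
      simp only [SetLike.coe_sort_coe, Fintype.card_coe] at this
      exact this.le
    simp only [hx0, sub_zero] at h1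
    exact h1.trans (mul_le_mul_of_nonneg_right (by exact_mod_cast h2) hB0)
  -- `K` receives `(1 + β) τ` and can absorb only `τ`; the rest has to leave.
  have hlow : β * τ ≤ ∑ i ∈ K, (weightedLaplacian w *ᵥ x) i := by
    calc β * τ = ∑ i ∈ K, (seedSource K β T s i - T i) := by
          rw [Finset.sum_sub_distrib, sum_seedSource hs, ← hτ]; ring
      _ ≤ _ := Finset.sum_le_sum fun i _ => h.gradient_nonneg hw i
  have hup : ∑ i ∈ K, (weightedLaplacian w *ᵥ x) i
      ≤ K.card * B * ∑ i ∈ K, ∑ j ∈ Kᶜ, w i j := by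
    rw [sum_weightedLaplacian_mulVec w hw, Finset.mul_sum]
    refine Finset.sum_le_sum fun i hi => ?_
    rw [Finset.mul_sum]
    refine Finset.sum_le_sum fun j _ => ?_
    have := hbound i hi
    have := h.1 j
    rw [mul_comm]
    exact mul_le_mul_of_nonneg_right (by linarith) (hw0 i j)
  have h3 : K.card * B * ∑ i ∈ K, ∑ j ∈ Kᶜ, w i j
      = (K.card * (1 + β) * ∑ i ∈ K, ∑ j ∈ Kᶜ, w i j) * (τ / c) := by
    rw [hB]; field_simp
  have h4 := mul_lt_mul_of_pos_right hcut (div_pos hTK hc)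
  have h5 : β * c * (τ / c) = β * τ := by field_simp
  linarith

theorem IsDualOptimal.sum_vecSupport_sdiff_le {w : Matrix V V ℝ} (hw : ∀ i j, w i j = w j i)
    (hw0 : ∀ i j, 0 ≤ w i j) {K : Finset V} {β : ℝ} {T x : V → ℝ} {s : V} (hs : s ∈ K)
    (h : IsDualOptimal w (seedSource K β T s) T x) (hK : K ⊆ vecSupport x) :
    ∑ i ∈ vecSupport x \ K, T i ≤ β * ∑ i ∈ K, T i := by
  have h1 := h.sum_vecSupport_le hw hw0
  rw [sum_seedSource (hK hs), ← Finset.sum_sdiff hK] at h1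
  linarith

end FlowDiffusion

/-! ### The recovery criterion at a fixed outcome of the model. -/

namespace ContextualLocalModel

variable {n : ℕ} {Ω : Type*} [MeasurableSpace Ω] {P : Measure Ω}

theorem weights_symm (M : ContextualLocalModel n P) (γ : ℝ) (ω : Ω) (i j : Fin n) :
    M.weights γ ω i j = M.weights γ ω j i := by
  unfold weights
  rw [norm_sub_rev]
  by_cases h : (M.graph ω).Adj i j
  · simp only [h, h.symm]
  · have h' : ¬ (M.graph ω).Adj j i := fun a => h a.symm
    simp only [h, h']

theorem weights_nonneg (M : ContextualLocalModel n P) (γ : ℝ) (ω : Ω) (i j : Fin n) :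
    0 ≤ M.weights γ ω i j := by
  unfold weights
  split_ifs
  · exact (Real.exp_pos _).le
  · exact le_rfl

/-- With at least two nodes, connectivity gives the seed a neighbour. Hence `T = deg` has positive
mass on `K` even though degrees may vanish elsewhere. -/
theorem recovers_of_connected (M : ContextualLocalModel n P) {γ β : ℝ} (hβ : 0 < β) {ω : Ω}
    (hconn : M.ClusterConnected ω) (hcard : 2 ≤ M.K.card)
    (hin : ∀ i ∈ M.K, ∀ j ∈ M.K, (M.graph ω).Adj i j → 1 / 2 ≤ M.weights γ ω i j)
    (hcut : M.K.card * (1 + β) * ∑ i ∈ M.K, ∑ j ∈ M.Kᶜ, M.weights γ ω i j < β * (1 / 2)) :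
    M.Recovers γ β ω := by
  intro s hs
  have key : ∀ T : Fin n → ℝ, (∀ i, 0 ≤ T i) → 0 < T s → ∀ x : Fin n → ℝ,
      IsDualOptimal (M.weights γ ω) (seedSource M.K β T s) T x →
        M.K ⊆ vecSupport x ∧ ∑ i ∈ vecSupport x \ M.K, T i ≤ β * ∑ i ∈ M.K, T i := by
    intro T hT hTs x hx
    have hsub := hx.subset_vecSupport (M.weights_symm γ ω) (M.weights_nonneg γ ω) hβ
      (by norm_num) hconn hin hcut hT (Finset.sum_pos' (fun i _ => hT i) ⟨s, hs, hTs⟩) hs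
    exact ⟨hsub, hx.sum_vecSupport_sdiff_le (M.weights_symm γ ω) (M.weights_nonneg γ ω) hs hsub⟩
  refine ⟨fun T hT => key T (fun i => zero_le_one.trans (hT i)) (zero_lt_one.trans_le (hT s)),
    fun x hx => ?_, fun x hx => ?_⟩
  · simpa using key (fun _ => 1) (by simp) (by simp) x hx
  · have hdeg : 0 < (nodeDegree (M.graph ω) s : ℝ) := by
      have : Nontrivial (M.K : Set (Fin n)) := by
        rw [Set.nontrivial_coe_sort, Finset.nontrivial_coe, ← Finset.one_lt_card_iff_nontrivial]
        exact hcard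
      obtain ⟨v, hv⟩ := hconn.preconnected.exists_adj_of_nontrivial ⟨s, hs⟩
      classical
      rw [nodeDegree, Nat.cast_pos, SimpleGraph.degree_pos_iff_exists_adj]
      exact ⟨v, hv⟩
    simpa [graphVolume] using key _ (fun i => Nat.cast_nonneg _) hdeg x hx

end ContextualLocalModel

/-! ### Concentration of the noise norms. -/

section Tail

variable {Ω : Type*} [MeasurableSpace Ω] {P : Measure Ω} [IsProbabilityMeasure P]

/-- A sub-Gaussian tail bounds the moment generating function of the square near zero. -/
theorem integrable_exp_mul_sq_and_mgf_sq_le {Y : Ω → ℝ} (hY : Measurable Y) {σ s : ℝ} (hσ : 0 < σ)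
    (hs : 0 < s) (hsσ : 4 * s * σ ^ 2 ≤ 1)
    (htail : ∀ t : ℝ, 0 ≤ t → P.real {ω | t ≤ |Y ω|} ≤ 2 * Real.exp (-(t ^ 2 / (2 * σ ^ 2)))) :
    Integrable (fun ω => Real.exp (s * Y ω ^ 2)) P ∧
      mgf (fun ω => Y ω ^ 2) P s ≤ Real.exp (8 * s * σ ^ 2) := by
  set b := 1 / (2 * σ ^ 2) with hb
  have hσ2 : 0 < σ ^ 2 := by positivity
  have hbs : 2 * s ≤ b := by rw [hb, le_div_iff₀ (by positivity)]; linarith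
  have hneg : -(b - s) < 0 := by linarith
  -- Layer cake: `E[exp (s Y²)] - 1` is the integral of `s exp (s t) P(Y² ≥ t)` over `t > 0`.
  have hlc := lintegral_comp_eq_lintegral_meas_le_mul P (f := fun ω => Y ω ^ 2)
    (g := fun t => s * Real.exp (s * t)) (ae_of_all _ fun ω => sq_nonneg (Y ω))
    (hY.pow_const 2).aemeasurable
    (fun t _ => (by fun_prop : Continuous fun t => s * Real.exp (s * t)).intervalIntegrable _ _)
    (ae_of_all _ fun t => by positivity)
  have hprim : ∀ y : ℝ, ∫ t in (0 : ℝ)..y, s * Real.exp (s * t) = Real.exp (s * y) - 1 := by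
    intro y
    rw [intervalIntegral.integral_eq_sub_of_hasDerivAt (f := fun t => Real.exp (s * t))]
    · simp
    · intro t _
      simpa [mul_comm] using ((hasDerivAt_id t).const_mul s).exp
    · exact (by fun_prop : Continuous fun t => s * Real.exp (s * t)).intervalIntegrable _ _
  simp only [hprim] at hlc
  have hbound : ∫⁻ t in Set.Ioi (0 : ℝ), P {ω | t ≤ Y ω ^ 2} * ENNReal.ofReal (s * Real.exp (s * t))
      ≤ ENNReal.ofReal (8 * s * σ ^ 2) := by
    have hint : Integrable (fun t => 2 * s * Real.exp (-(b - s) * t))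
        (volume.restrict (Set.Ioi (0 : ℝ))) := (integrableOn_exp_mul_Ioi hneg 0).const_mul _
    calc _ ≤ ∫⁻ t in Set.Ioi (0 : ℝ), ENNReal.ofReal (2 * s * Real.exp (-(b - s) * t)) := by
          refine setLIntegral_mono' measurableSet_Ioi fun t ht => ?_
          have ht0 : (0 : ℝ) ≤ t := le_of_lt ht
          have h1 := htail (Real.sqrt t) (Real.sqrt_nonneg t)
          have h2 : {ω | Real.sqrt t ≤ |Y ω|} = {ω | t ≤ Y ω ^ 2} := by
            ext ω
            simp only [Set.mem_ofPred_eq]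
            rw [Real.sqrt_le_left (abs_nonneg _), sq_abs]
          rw [h2, Real.sq_sqrt ht0] at h1
          rw [← ofReal_measureReal, ← ENNReal.ofReal_mul measureReal_nonneg]
          refine ENNReal.ofReal_le_ofReal ?_
          calc _ ≤ 2 * Real.exp (-(t / (2 * σ ^ 2))) * (s * Real.exp (s * t)) :=
                mul_le_mul_of_nonneg_right h1 (by positivity)
            _ = 2 * s * (Real.exp (-(t / (2 * σ ^ 2))) * Real.exp (s * t)) := by ring
            _ = _ := by
                rw [← Real.exp_add]
                congr 2
                rw [hb]; ring
      _ = ENNReal.ofReal (∫ t in Set.Ioi (0 : ℝ), 2 * s * Real.exp (-(b - s) * t)) :=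
          (ofReal_integral_eq_lintegral_ofReal hint (ae_of_all _ fun t => by positivity)).symm
      _ ≤ _ := by
          refine ENNReal.ofReal_le_ofReal ?_
          rw [integral_const_mul, integral_exp_mul_Ioi hneg]
          simp only [mul_zero, Real.exp_zero, neg_div_neg_eq]
          -- Since `2 s ≤ b`, the decay rate `b - s` is at least `b / 2`, which yields `4 s / b = 8
          -- s σ²`.
          have : 2 * s * (1 / (b - s)) ≤ 2 * s * (1 / (b / 2)) := by (gcongr; linarith)
          refine this.trans (le_of_eq ?_)
          rw [hb]; field_simp; norm_num
  rw [← hlc] at hbound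
  have hnn : ∀ ω, 0 ≤ Real.exp (s * Y ω ^ 2) - 1 := fun ω => by
    have := Real.one_le_exp (x := s * Y ω ^ 2) (by positivity)
    linarith
  have hmeas : Measurable fun ω => Real.exp (s * Y ω ^ 2) - 1 := by fun_prop
  have hint : Integrable (fun ω => Real.exp (s * Y ω ^ 2) - 1) P := by
    refine ⟨hmeas.aestronglyMeasurable, ?_⟩
    rw [hasFiniteIntegral_iff_ofReal (ae_of_all _ hnn)]
    exact hbound.trans_lt ENNReal.ofReal_lt_top
  have hint' : Integrable (fun ω => Real.exp (s * Y ω ^ 2)) P := by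
    refine (hint.add (integrable_const (1 : ℝ))).congr (ae_of_all _ fun ω => ?_)
    simp
  refine ⟨hint', ?_⟩
  rw [← ofReal_integral_eq_lintegral_ofReal hint (ae_of_all _ hnn),
    ENNReal.ofReal_le_ofReal_iff (by positivity), integral_sub hint' (integrable_const _)] at hbound
  simp only [integral_const, probReal_univ, smul_eq_mul, mul_one] at hbound
  unfold mgf
  linarith [Real.add_one_le_exp (8 * s * σ ^ 2)]

end Tail

namespace ContextualLocalModel

variable {n : ℕ} {Ω : Type*} [MeasurableSpace Ω] {P : Measure Ω}

theorem sigma_le_sigmaHat (M : ContextualLocalModel n P) (l : Fin M.d) :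
    M.sigma l ≤ M.sigmaHat :=
  le_ciSup (Set.finite_range M.sigma).bddAbove l

/-- Chernoff's bound with parameter `1 / (4 σ̂²)`, small enough for the square of every coordinate
to have an exponential moment; independence multiplies these moments. -/
theorem measureReal_le_sum_Z_sq [IsProbabilityMeasure P] (M : ContextualLocalModel n P)
    (hσ : 0 < M.sigmaHat) (i : Fin n) (a : ℝ) :
    P.real {ω | a ≤ ∑ l, M.Z i l ω ^ 2}
      ≤ Real.exp (2 * ∑ l, M.sigma l ^ 2 / M.sigmaHat ^ 2 - a / (4 * M.sigmaHat ^ 2)) := by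
  set s := 1 / (4 * M.sigmaHat ^ 2) with hs
  have hs0 : 0 < s := by positivity
  have h8 : ∀ l, 8 * s * M.sigma l ^ 2 = 2 * (M.sigma l ^ 2 / M.sigmaHat ^ 2) := fun l => by
    rw [hs]; field_simp; ring
  have hcoord : ∀ l, Integrable (fun ω => Real.exp (s * M.Z i l ω ^ 2)) P ∧
      mgf (fun ω => M.Z i l ω ^ 2) P s ≤ Real.exp (8 * s * M.sigma l ^ 2) := fun l => by
    refine integrable_exp_mul_sq_and_mgf_sq_le (M.measurable_Z i l) (M.sigma_pos l) hs0 ?_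
      (M.subGaussian i l)
    rw [hs, show 4 * (1 / (4 * M.sigmaHat ^ 2)) * M.sigma l ^ 2
      = M.sigma l ^ 2 / M.sigmaHat ^ 2 by field_simp, div_le_one (by positivity)]
    exact pow_le_pow_left₀ (M.sigma_pos l).le (M.sigma_le_sigmaHat l) 2
  have hind : iIndepFun (fun l ω => M.Z i l ω ^ 2) P := by
    have h1 := M.independent.precomp (g := fun l : Fin M.d => Sum.inr (i, l))
      (fun a b h => by simpa using h)
    exact h1.comp (fun _ x => x ^ 2) fun _ => measurable_id.pow_const 2
  have hmeas : ∀ l, Measurable fun ω => M.Z i l ω ^ 2 := fun l => (M.measurable_Z i l).pow_const 2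
  have hint := hind.integrable_exp_mul_sum (s := Finset.univ) (t := s) hmeas
    fun l _ => (hcoord l).1
  have hch := measure_ge_le_exp_mul_mgf a hs0.le hint
  rw [hind.mgf_sum hmeas] at hch
  simp only [Finset.sum_apply] at hch
  calc _ ≤ _ := hch
    _ ≤ Real.exp (-s * a) * ∏ l, Real.exp (8 * s * M.sigma l ^ 2) :=
        mul_le_mul_of_nonneg_left
          (Finset.prod_le_prod (fun l _ => mgf_nonneg) fun l _ => (hcoord l).2) (Real.exp_pos _).le
    _ = _ := by
        rw [← Real.exp_sum, ← Real.exp_add]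
        simp only [h8, ← Finset.mul_sum]
        congr 1
        rw [hs]; ring

end ContextualLocalModel

/-! ### Connectivity of the cluster, and its independence from noise and boundary edges. -/

/-- A disconnected induced subgraph has a nonempty set of at most half of its nodes that no edge
leaves. -/
theorem SimpleGraph.exists_isolated_of_not_connected_induce {V : Type*} [DecidableEq V]
    {H : SimpleGraph V} {K : Finset V} (hK : K.Nonempty)
    (hH : ¬ (H.induce (K : Set V)).Connected) :
    ∃ S ⊆ K, S.Nonempty ∧ 2 * S.card ≤ K.card ∧ ∀ i ∈ S, ∀ j ∈ K \ S, ¬ H.Adj i j := by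
  classical
  rw [SimpleGraph.connected_iff] at hH
  have hpre : ¬ (H.induce (K : Set V)).Preconnected := fun h =>
    hH ⟨h, hK.to_subtype⟩
  obtain ⟨a, b, hab⟩ : ∃ a b, ¬ (H.induce (K : Set V)).Reachable a b := by
    by_contra! h
    exact hpre h
  -- `A` is the component of `a`; no edge joins `A` to `K \ A`, and one of the two has at most half
  -- of the nodes.
  set A : Finset V := K.filter fun v => ∃ hv : v ∈ K, (H.induce (K : Set V)).Reachable a ⟨v, hv⟩
    with hA
  have haA : (a : V) ∈ A := Finset.mem_filter.2 ⟨a.2, a.2, SimpleGraph.Reachable.refl _⟩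
  have hbA : (b : V) ∈ K \ A := by
    refine Finset.mem_sdiff.2 ⟨b.2, fun h => ?_⟩
    obtain ⟨_, hv⟩ := (Finset.mem_filter.1 h).2
    exact hab hv
  have hAK : A ⊆ K := Finset.filter_subset _ _
  have hno : ∀ i ∈ A, ∀ j ∈ K \ A, ¬ H.Adj i j := by
    intro i hi j hj hij
    obtain ⟨hiK, hr⟩ := (Finset.mem_filter.1 hi).2
    obtain ⟨hjK, hjA⟩ := Finset.mem_sdiff.1 hj
    refine hjA (Finset.mem_filter.2 ⟨hjK, hjK, hr.trans ?_⟩)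
    exact SimpleGraph.Adj.reachable (G := H.induce (K : Set V)) (u := ⟨i, hiK⟩) (v := ⟨j, hjK⟩) hij
  have hcard := Finset.card_sdiff_add_card_eq_card hAK
  rcases le_total (2 * A.card) K.card with h | h
  · exact ⟨A, hAK, ⟨a, haA⟩, h, hno⟩
  · refine ⟨K \ A, Finset.sdiff_subset, ⟨b, hbA⟩, by omega, fun i hi j hj hij => ?_⟩
    rw [Finset.sdiff_sdiff_eq_self hAK] at hj
    exact hno j hj i hi hij.symm

namespace ContextualLocalModel

variable {n : ℕ} {Ω : Type*} [MeasurableSpace Ω] {P : Measure Ω}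

/-- The pair `{i, j}` as an index of the edges that touch the cluster. -/
def clusterPair {K : Finset (Fin n)} (i j : Fin n) (hij : i ≠ j) (hi : i ∈ K) : ClusterPair K :=
  ⟨(min i j, max i j), min_lt_max.2 hij, by
    rcases le_total i j with h | h
    · left; rwa [min_eq_left h]
    · right; rwa [max_eq_left h]⟩

/-- The independent family of edge indicators and noise coordinates. -/
noncomputable def source (M : ContextualLocalModel n P) :
    ClusterPair M.K ⊕ (Fin n × Fin M.d) → Ω → ℝ :=
  Sum.elim
    (fun (e : ClusterPair M.K) (ω : Ω) =>
      Set.indicator {ω' | (M.graph ω').Adj e.1.1 e.1.2} (fun _ => (1 : ℝ)) ω)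
    (fun (c : Fin n × Fin M.d) (ω : Ω) => M.Z c.1 c.2 ω)

theorem setOf_adj_clusterPair (M : ContextualLocalModel n P) {i j : Fin n} (hij : i ≠ j)
    (hi : i ∈ M.K) :
    {ω | (M.graph ω).Adj i j}
      = M.source (Sum.inl (clusterPair i j hij hi)) ⁻¹' {1} := by
  ext ω
  have h : (M.graph ω).Adj (min i j) (max i j) ↔ (M.graph ω).Adj i j := by
    rcases le_total i j with h | h
    · rw [min_eq_left h, max_eq_right h]
    · rw [min_eq_right h, max_eq_left h, SimpleGraph.adj_comm]
  simp [source, clusterPair, h]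

theorem measurable_source (M : ContextualLocalModel n P)
    (a : ClusterPair M.K ⊕ (Fin n × Fin M.d)) : Measurable (M.source a) := by
  rcases a with e | c
  · exact measurable_const.indicator (M.measurableSet_adj _ _)
  · exact M.measurable_Z _ _

/-- The events determined by the sources in `S`. -/
noncomputable abbrev sourceEvents (M : ContextualLocalModel n P)
    (S : Set (ClusterPair M.K ⊕ (Fin n × Fin M.d))) : MeasurableSpace Ω :=
  ⨆ a ∈ S, MeasurableSpace.comap (M.source a) inferInstance

theorem measurable_source_sourceEvents (M : ContextualLocalModel n P)
    {S : Set (ClusterPair M.K ⊕ (Fin n × Fin M.d))} {a} (ha : a ∈ S) :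
    Measurable[M.sourceEvents S] (M.source a) :=
  (comap_measurable (M.source a)).mono
    (le_iSup₂ (f := fun a (_ : a ∈ S) => MeasurableSpace.comap (M.source a) inferInstance) a ha)
    le_rfl

/-- The indices of the edges inside the cluster. -/
def insidePairs (M : ContextualLocalModel n P) : Set (ClusterPair M.K ⊕ (Fin n × Fin M.d)) :=
  {a | ∃ e : ClusterPair M.K, a = Sum.inl e ∧ e.1.1 ∈ M.K ∧ e.1.2 ∈ M.K}

/-- Connectivity is a function of the adjacency matrix on `K`, which takes finitely many values and
is determined by the inside edges. -/
theorem measurableSet_clusterConnected_insidePairs (M : ContextualLocalModel n P) :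
    MeasurableSet[M.sourceEvents M.insidePairs] {ω | M.ClusterConnected ω} := by
  have hadj : ∀ i j : (M.K : Set (Fin n)),
      MeasurableSet[M.sourceEvents M.insidePairs] {ω | (M.graph ω).Adj i j} := by
    intro i j
    rcases eq_or_ne (i : Fin n) j with hij | hij
    · simp [hij]
    · rw [M.setOf_adj_clusterPair hij i.2]
      refine M.measurable_source_sourceEvents ?_ (measurableSet_singleton 1)
      refine ⟨_, rfl, ?_⟩
      have hi : (i : Fin n) ∈ M.K := i.2
      have hj : (j : Fin n) ∈ M.K := j.2
      rcases le_total (i : Fin n) j with h | h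
      · simp [clusterPair, h, hi, hj]
      · simp [clusterPair, h, hi, hj]
  let A : Ω → (↥(M.K : Set (Fin n)) → ↥(M.K : Set (Fin n)) → Prop) :=
    fun ω i j => (M.graph ω).Adj i j
  have hA : @Measurable _ _ (M.sourceEvents M.insidePairs) _ A :=
    @measurable_pi_lambda _ _ _ (M.sourceEvents M.insidePairs) _ _ fun i =>
      @measurable_pi_lambda _ _ _ (M.sourceEvents M.insidePairs) _ _ fun j =>
        (@measurableSet_setOfPred _ (M.sourceEvents M.insidePairs) _).1 (hadj i j)
  have hpre : {ω | M.ClusterConnected ω} = A ⁻¹' (A '' {ω | M.ClusterConnected ω}) := by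
    refine (Set.subset_preimage_image A _).antisymm ?_
    rintro ω ⟨ω', hω', heq⟩
    have : (M.graph ω).induce (M.K : Set (Fin n)) = (M.graph ω').induce (M.K : Set (Fin n)) := by
      ext i j
      exact iff_of_eq (congrFun (congrFun heq i) j).symm
    simp only [Set.mem_ofPred_eq, ClusterConnected] at hω' ⊢
    rwa [this]
  rw [hpre]
  exact hA (Set.toFinite _).measurableSet

theorem measurableSet_clusterConnected (M : ContextualLocalModel n P) :
    MeasurableSet {ω | M.ClusterConnected ω} :=
  iSup₂_le (fun a _ => (M.measurable_source a).comap_le) _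
    M.measurableSet_clusterConnected_insidePairs

theorem indep_sourceEvents_insidePairs (M : ContextualLocalModel n P) :
    Indep (M.sourceEvents M.insidePairs) (M.sourceEvents M.insidePairsᶜ) P :=
  indep_iSup_of_disjoint (fun a => (M.measurable_source a).comap_le)
    ((iIndepFun_iff_iIndep _ _ _).1 M.independent) disjoint_compl_right

/-- This factorization lets every later bound carry the factor `P(K connected)`, hence hold
conditionally without dividing by it. -/
theorem measureReal_clusterConnected_inter (M : ContextualLocalModel n P) {E : Set Ω}
    (hE : MeasurableSet[M.sourceEvents M.insidePairsᶜ] E) :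
    P.real ({ω | M.ClusterConnected ω} ∩ E)
      = P.real {ω | M.ClusterConnected ω} * P.real E := by
  have := (Indep_iff _ _ _).1 M.indep_sourceEvents_insidePairs _ _
    M.measurableSet_clusterConnected_insidePairs hE
  simp only [measureReal_def, this, ENNReal.toReal_mul]

theorem measureReal_clusterConnected_inter_adj (M : ContextualLocalModel n P) {i j : Fin n}
    (hi : i ∈ M.K) (hj : j ∉ M.K) :
    P.real ({ω | M.ClusterConnected ω} ∩ {ω | (M.graph ω).Adj i j})
      = P.real {ω | M.ClusterConnected ω} * M.q := by
  have hij : i ≠ j := fun h => hj (h ▸ hi)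
  rw [M.measureReal_clusterConnected_inter, M.prob_across i hi j hj]
  rw [M.setOf_adj_clusterPair hij hi]
  refine M.measurable_source_sourceEvents ?_ (measurableSet_singleton 1)
  rintro ⟨e, he, h1, h2⟩
  rw [← Sum.inl.inj he] at h1 h2
  rcases le_total i j with h | h
  · exact hj (by simpa [clusterPair, h] using h2)
  · exact hj (by simpa [clusterPair, h] using h1)

theorem measureReal_clusterConnected_inter_noise (M : ContextualLocalModel n P) (i : Fin n)
    (a : ℝ) :
    P.real ({ω | M.ClusterConnected ω} ∩ {ω | a ≤ ∑ l, M.Z i l ω ^ 2})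
      = P.real {ω | M.ClusterConnected ω} * P.real {ω | a ≤ ∑ l, M.Z i l ω ^ 2} := by
  refine M.measureReal_clusterConnected_inter ?_
  have hZ : ∀ l, Measurable[M.sourceEvents M.insidePairsᶜ] (M.Z i l) := fun l =>
    M.measurable_source_sourceEvents (a := Sum.inr (i, l)) (by rintro ⟨e, he, -⟩; simp at he)
  have hsum : Measurable[M.sourceEvents M.insidePairsᶜ] fun ω => ∑ l, M.Z i l ω ^ 2 :=
    Finset.measurable_fun_sum _ fun l _ => (hZ l).pow_const 2
  exact hsum measurableSet_Ici

/-- The probability that no edge joins two disjoint parts of the cluster. -/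
theorem measureReal_forall_not_adj [IsProbabilityMeasure P] (M : ContextualLocalModel n P)
    {S : Finset (Fin n)} (hS : S ⊆ M.K) :
    P.real {ω | ∀ i ∈ S, ∀ j ∈ M.K \ S, ¬ (M.graph ω).Adj i j}
      = (1 - M.p) ^ (S.card * (M.K.card - S.card)) := by
  have hne : ∀ e : ↥(S ×ˢ (M.K \ S)), e.1.1 ≠ e.1.2 := fun e h => by
    have h1 := Finset.mem_product.1 e.2
    exact (Finset.mem_sdiff.1 h1.2).2 (h ▸ h1.1)
  have hmem : ∀ e : ↥(S ×ˢ (M.K \ S)), e.1.1 ∈ M.K := fun e => hS (Finset.mem_product.1 e.2).1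
  let g : ↥(S ×ˢ (M.K \ S)) → ClusterPair M.K ⊕ (Fin n × Fin M.d) :=
    fun e => Sum.inl (clusterPair e.1.1 e.1.2 (hne e) (hmem e))
  -- The unordered pair determines the ordered one, as its first node lies in `S` and its second
  -- does not.
  have hg : Function.Injective g := by
    intro e e' h
    have h1 := Finset.mem_product.1 e.2
    have h2 := Finset.mem_product.1 e'.2
    have h3 := (Finset.mem_sdiff.1 h1.2).2
    have h4 := (Finset.mem_sdiff.1 h2.2).2
    have h5 := congrArg Subtype.val (Sum.inl.inj h)
    simp only [clusterPair, Prod.mk.injEq] at h5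
    refine Subtype.ext (Prod.ext ?_ ?_) <;>
    rcases le_total e.1.1 e.1.2 with a | a <;> rcases le_total e'.1.1 e'.1.2 with b | b <;>
    simp only [a, b, min_eq_left, min_eq_right, max_eq_left, max_eq_right] at h5 <;>
    first
    | exact h5.1
    | exact h5.2
    | exact absurd h1.1 (h5.1.symm ▸ h4)
    | exact absurd h1.1 (h5.2.symm ▸ h4)
  have hind := (iIndepFun.precomp hg (show iIndepFun M.source P from M.independent)).meas_iInter
    (s := fun e => {ω | (M.graph ω).Adj e.1.1 e.1.2}ᶜ) (fun e => by
      refine ⟨{1}ᶜ, (measurableSet_singleton 1).compl, ?_⟩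
      rw [M.setOf_adj_clusterPair (hne e) (hmem e)]
      rfl)
  have hset : {ω | ∀ i ∈ S, ∀ j ∈ M.K \ S, ¬ (M.graph ω).Adj i j}
      = ⋂ e : ↥(S ×ˢ (M.K \ S)), {ω | (M.graph ω).Adj e.1.1 e.1.2}ᶜ := by
    ext ω
    simp only [Set.mem_ofPred_eq, Set.mem_iInter, Set.mem_compl_iff, Subtype.forall,
      Finset.mem_product, Prod.forall]
    exact ⟨fun h i j hij => h i hij.1 j hij.2, fun h i hi j hj => h i j ⟨hi, hj⟩⟩
  have hval : ∀ e : ↥(S ×ˢ (M.K \ S)),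
      (P {ω | (M.graph ω).Adj e.1.1 e.1.2}ᶜ).toReal = 1 - M.p := fun e => by
    rw [← measureReal_def, probReal_compl_eq_one_sub (M.measurableSet_adj _ _),
      M.prob_inside _ (hmem e) _ (Finset.mem_sdiff.1 (Finset.mem_product.1 e.2).2).1 (hne e)]
  rw [hset, measureReal_def, hind, ENNReal.toReal_prod]
  simp only [hval, Finset.prod_const, Finset.card_univ, Fintype.card_coe, Finset.card_product,
    Finset.card_sdiff_of_subset hS]

/-- An Erdős–Rényi graph above the connectivity threshold is connected. -/
theorem measureReal_not_clusterConnected_le [IsProbabilityMeasure P]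
    (M : ContextualLocalModel n P) {ε : ℝ} (hε : 0 < ε) (hk : 2 ≤ M.K.card)
    (hp : (4 + ε) * Real.log M.k ≤ M.p * (M.k - 1)) :
    P.real {ω | ¬ M.ClusterConnected ω} ≤ Real.exp 1 * M.k ^ (-(ε / 2)) := by
  have hk2 : (2 : ℝ) ≤ M.k := by unfold k; exact_mod_cast hk
  have hkpos : 0 < M.k := by linarith
  -- `a` bounds `(1 - p)^(k - |S|)`: here `k - |S| ≥ (k - 1) / 2` and `p (k - 1) ≥ (4 + ε) log k`.
  set a : ℝ := M.k ^ (-(2 + ε / 2)) with ha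
  have ha0 : 0 < a := Real.rpow_pos_of_pos hkpos _
  set F : Finset (Finset (Fin n)) :=
    M.K.powerset.filter fun S => S.Nonempty ∧ 2 * S.card ≤ M.K.card with hF
  have hsub : {ω | ¬ M.ClusterConnected ω}
      ⊆ ⋃ S ∈ F, {ω | ∀ i ∈ S, ∀ j ∈ M.K \ S, ¬ (M.graph ω).Adj i j} := by
    intro ω hω
    obtain ⟨S, h1, h2, h3, h4⟩ := SimpleGraph.exists_isolated_of_not_connected_induce
      (Finset.card_pos.1 (by omega)) hω
    exact Set.mem_biUnion (Finset.mem_coe.2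
      (Finset.mem_filter.2 ⟨Finset.mem_powerset.2 h1, h2, h3⟩)) h4
  have hterm : ∀ S ∈ F, P.real {ω | ∀ i ∈ S, ∀ j ∈ M.K \ S, ¬ (M.graph ω).Adj i j}
      ≤ a ^ S.card := by
    intro S hS
    obtain ⟨h1, h2, h3⟩ := Finset.mem_filter.1 hS
    rw [M.measureReal_forall_not_adj (Finset.mem_powerset.1 h1), mul_comm, pow_mul]
    refine pow_le_pow_left₀ (pow_nonneg (by linarith [M.p_mem.2]) _) ?_ _
    have h4 : (M.k - 1) / 2 ≤ ((M.K.card - S.card : ℕ) : ℝ) := by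
      have : M.K.card ≤ 2 * (M.K.card - S.card) := by omega
      have : (M.K.card : ℝ) ≤ 2 * ((M.K.card - S.card : ℕ) : ℝ) := by exact_mod_cast this
      unfold k
      linarith
    calc (1 - M.p) ^ (M.K.card - S.card)
        ≤ Real.exp (-M.p) ^ (M.K.card - S.card) :=
          pow_le_pow_left₀ (by linarith [M.p_mem.2])
            (by linarith [Real.add_one_le_exp (-M.p)]) _
      _ = Real.exp (-(M.p * ((M.K.card - S.card : ℕ) : ℝ))) := by
          rw [← Real.exp_nat_mul]; congr 1; ring
      _ ≤ a := by
          rw [ha, Real.rpow_def_of_pos hkpos, Real.exp_le_exp]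
          have := mul_le_mul_of_nonneg_left h4 M.p_mem.1
          linarith
  -- Enlarging the family to all nonempty subsets of `K` allows the binomial theorem.
  have hsum : ∑ S ∈ F, a ^ S.card ≤ (a + 1) ^ M.K.card - 1 := by
    rw [← Finset.sum_pow_mul_eq_add_pow a 1 M.K]
    simp only [one_pow, mul_one]
    have h1 : F ⊆ M.K.powerset.erase ∅ := fun S hS => by
      obtain ⟨h1, h2, h3⟩ := Finset.mem_filter.1 hS
      exact Finset.mem_erase.2 ⟨h2.ne_empty, h1⟩
    rw [← Finset.add_sum_erase _ _ (Finset.empty_mem_powerset M.K)]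
    simp only [Finset.card_empty, pow_zero, add_sub_cancel_left]
    exact Finset.sum_le_sum_of_subset_of_nonneg h1 fun S _ _ => pow_nonneg ha0.le _
  have hka : M.k * a ≤ M.k ^ (-(ε / 2)) := by
    rw [ha]
    nth_rewrite 1 [← Real.rpow_one M.k]
    rw [← Real.rpow_add hkpos]
    exact Real.rpow_le_rpow_of_exponent_le (by linarith) (by linarith)
  have hle1 : M.k ^ (-(ε / 2)) ≤ 1 :=
    Real.rpow_le_one_of_one_le_of_nonpos (by linarith) (by linarith)
  have hx0 : 0 ≤ M.k * a := by positivity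
  have hexp : (a + 1) ^ M.K.card ≤ Real.exp (M.k * a) := by
    calc (a + 1) ^ M.K.card ≤ Real.exp a ^ M.K.card :=
          pow_le_pow_left₀ (by positivity) (Real.add_one_le_exp a) _
      _ = _ := by rw [← Real.exp_nat_mul]; rfl
  -- From `1 - x ≤ exp (-x)` follows `exp x - 1 ≤ x exp x`, and here `x ≤ 1`.
  have hconv : Real.exp (M.k * a) - 1 ≤ Real.exp 1 * (M.k * a) := by
    have h1 := Real.add_one_le_exp (-(M.k * a))
    have h2 : Real.exp (M.k * a) * Real.exp (-(M.k * a)) = 1 := by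
      rw [← Real.exp_add]; simp
    have h3 : Real.exp (M.k * a) ≤ Real.exp 1 := Real.exp_le_exp.2 (hka.trans hle1)
    nlinarith [Real.exp_pos (M.k * a)]
  calc P.real {ω | ¬ M.ClusterConnected ω}
      ≤ P.real (⋃ S ∈ F, {ω | ∀ i ∈ S, ∀ j ∈ M.K \ S, ¬ (M.graph ω).Adj i j}) :=
        measureReal_mono hsub (measure_ne_top _ _)
    _ ≤ ∑ S ∈ F, P.real {ω | ∀ i ∈ S, ∀ j ∈ M.K \ S, ¬ (M.graph ω).Adj i j} :=
        measureReal_biUnion_finset_le _ _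
    _ ≤ ∑ S ∈ F, a ^ S.card := Finset.sum_le_sum hterm
    _ ≤ Real.exp 1 * (M.k * a) := by linarith
    _ ≤ _ := mul_le_mul_of_nonneg_left hka (Real.exp_pos 1).le

end ContextualLocalModel

/-! ### Edge weights under small noise, and the failure probability at fixed `n`. -/

namespace ContextualLocalModel

variable {n : ℕ} {Ω : Type*} [MeasurableSpace Ω] {P : Measure Ω}

theorem muHat_nonneg (M : ContextualLocalModel n P) : 0 ≤ M.muHat :=
  Real.iInf_nonneg fun _ => norm_nonneg _

theorem muHat_le (M : ContextualLocalModel n P) {i j : Fin n} (hi : i ∈ M.K) (hj : j ∉ M.K) :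
    M.muHat ≤ ‖M.mu i - M.mu j‖ :=
  ciInf_le (f := fun e : {e : Fin n × Fin n // e.1 ∈ M.K ∧ e.2 ∉ M.K} =>
    ‖M.mu e.1.1 - M.mu e.1.2‖) ⟨0, by rintro _ ⟨e, rfl⟩; exact norm_nonneg _⟩ ⟨(i, j), hi, hj⟩

/-- In dimension zero all signals coincide, so a nonzero `μ̂` forces a coordinate to exist. -/
theorem sigmaHat_pos_of_muHat_ne_zero (M : ContextualLocalModel n P) (h : M.muHat ≠ 0) :
    0 < M.sigmaHat := by
  have hd : M.d ≠ 0 := by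
    intro hd
    have : IsEmpty (Fin M.d) := by rw [hd]; infer_instance
    have : Subsingleton (EuclideanSpace ℝ (Fin M.d)) :=
      ⟨fun x y => by ext l; exact isEmptyElim l⟩
    refine h ?_
    simp only [muHat, Subsingleton.elim _ (0 : EuclideanSpace ℝ (Fin M.d)), norm_zero,
      Real.iInf_const_zero]
  let l : Fin M.d := ⟨0, Nat.pos_of_ne_zero hd⟩
  exact (M.sigma_pos l).trans_le (M.sigma_le_sigmaHat l)

theorem norm_noise_le (M : ContextualLocalModel n P) {ω : Ω} {ρ : ℝ} (hρ : 0 ≤ ρ) {i : Fin n}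
    (h : ∑ l, M.Z i l ω ^ 2 < ρ ^ 2) :
    ‖(WithLp.toLp 2 (fun l => M.Z i l ω) : EuclideanSpace ℝ (Fin M.d))‖ ≤ ρ := by
  refine le_of_sq_le_sq ?_ hρ
  rw [EuclideanSpace.real_norm_sq_eq]
  exact h.le

theorem half_le_weights (M : ContextualLocalModel n P) {γ ρ : ℝ} {ω : Ω} (hγ : 0 ≤ γ)
    (hρ : 0 ≤ ρ) (hZ : ∀ i, ∑ l, M.Z i l ω ^ 2 < ρ ^ 2) (hγρ : γ * (2 * ρ) ^ 2 ≤ Real.log 2)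
    {i j : Fin n} (hi : i ∈ M.K) (hj : j ∈ M.K) (hij : (M.graph ω).Adj i j) :
    1 / 2 ≤ M.weights γ ω i j := by
  -- Inside `K` the signals cancel and only the two noise vectors remain.
  have h1 : ‖M.X i ω - M.X j ω‖ ≤ 2 * ρ := by
    rw [X, X, M.mu_eq i hi j hj, add_sub_add_left_eq_sub]
    refine (norm_sub_le _ _).trans ?_
    linarith [M.norm_noise_le hρ (hZ i), M.norm_noise_le hρ (hZ j)]
  have h2 : γ * ‖M.X i ω - M.X j ω‖ ^ 2 ≤ Real.log 2 :=
    (mul_le_mul_of_nonneg_left (pow_le_pow_left₀ (norm_nonneg _) h1 2) hγ).trans hγρ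
  simp only [weights, hij, if_true]
  calc (1 : ℝ) / 2 = Real.exp (-Real.log 2) := by
        rw [Real.exp_neg, Real.exp_log (by norm_num)]; norm_num
    _ ≤ _ := Real.exp_le_exp.2 (by linarith)

open Classical in
theorem weights_le_of_across (M : ContextualLocalModel n P) {γ ρ : ℝ} {ω : Ω} (hγ : 0 ≤ γ)
    (hρ : 0 ≤ ρ) (hZ : ∀ i, ∑ l, M.Z i l ω ^ 2 < ρ ^ 2) (hρμ : 4 * ρ ≤ M.muHat)
    {i j : Fin n} (hi : i ∈ M.K) (hj : j ∉ M.K) :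
    M.weights γ ω i j
      ≤ (if (M.graph ω).Adj i j then 1 else 0) * Real.exp (-(γ * M.muHat ^ 2 / 4)) := by
  by_cases hij : (M.graph ω).Adj i j
  · have h1 : M.muHat / 2 ≤ ‖M.X i ω - M.X j ω‖ := by
      have h2 : M.mu i - M.mu j = (M.X i ω - M.X j ω)
          + ((WithLp.toLp 2 (fun l => M.Z j l ω) : EuclideanSpace ℝ (Fin M.d))
            - WithLp.toLp 2 (fun l => M.Z i l ω)) := by
        rw [X, X]; abel
      have h3 := M.muHat_le hi hj
      rw [h2] at h3
      have h4 := norm_add_le (M.X i ω - M.X j ω)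
        ((WithLp.toLp 2 (fun l => M.Z j l ω) : EuclideanSpace ℝ (Fin M.d))
            - WithLp.toLp 2 (fun l => M.Z i l ω))
      have h5 := norm_sub_le (WithLp.toLp 2 (fun l => M.Z j l ω) : EuclideanSpace ℝ (Fin M.d))
        (WithLp.toLp 2 (fun l => M.Z i l ω))
      linarith [M.norm_noise_le hρ (hZ i), M.norm_noise_le hρ (hZ j)]
    simp only [weights, hij, if_true, one_mul]
    refine Real.exp_le_exp.2 ?_
    have h2 := mul_le_mul_of_nonneg_left
      (pow_le_pow_left₀ (by linarith [M.muHat_nonneg]) h1 2) hγ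
    nlinarith
  · simp [weights, hij]

open Classical in
/-- Markov's inequality for the number of boundary edges of the cluster. -/
theorem mul_measureReal_clusterConnected_inter_le [IsProbabilityMeasure P]
    (M : ContextualLocalModel n P) (a : ℝ) :
    a * P.real {ω | M.ClusterConnected ω ∧
        a ≤ ∑ i ∈ M.K, ∑ j ∈ M.Kᶜ, if (M.graph ω).Adj i j then (1 : ℝ) else 0}
      ≤ P.real {ω | M.ClusterConnected ω} * (M.k * (M.q * (n - M.k))) := by
  rcases le_or_gt a 0 with ha | ha
  · refine (mul_nonpos_of_nonpos_of_nonneg ha measureReal_nonneg).trans ?_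
    have : M.k ≤ n := by
      unfold k
      exact_mod_cast (Finset.card_le_univ M.K).trans_eq (Fintype.card_fin n)
    exact mul_nonneg measureReal_nonneg
      (mul_nonneg (Nat.cast_nonneg _) (mul_nonneg M.q_mem.1 (by linarith)))
  set C := {ω | M.ClusterConnected ω} with hC
  -- The boundary edges are counted only on the connectivity event, so that the mean carries the
  -- factor `P(C)`.
  set f : Ω → ℝ := fun ω => ∑ i ∈ M.K, ∑ j ∈ M.Kᶜ,
    (C ∩ {ω | (M.graph ω).Adj i j}).indicator (fun _ => (1 : ℝ)) ω with hf
  have hmeas : ∀ i j, MeasurableSet (C ∩ {ω | (M.graph ω).Adj i j}) := fun i j =>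
    M.measurableSet_clusterConnected.inter (M.measurableSet_adj i j)
  have hint1 : ∀ i j, Integrable
      ((C ∩ {ω | (M.graph ω).Adj i j}).indicator (fun _ => (1 : ℝ))) P := fun i j =>
    (integrable_const 1).indicator (hmeas i j)
  have hint : Integrable f P :=
    integrable_finsetSum _ fun i _ => integrable_finsetSum _ fun j _ => hint1 i j
  have h1 := mul_meas_ge_le_integral_of_nonneg (ae_of_all _ fun ω =>
    Finset.sum_nonneg fun i _ => Finset.sum_nonneg fun j _ =>
      Set.indicator_nonneg (fun _ _ => zero_le_one) ω) hint a
  have h2 : ∫ ω, f ω ∂P = P.real C * (M.k * (M.q * (n - M.k))) := by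
    simp only [hf]
    rw [integral_finsetSum _ fun i _ => integrable_finsetSum _ fun j _ => hint1 i j]
    have h3 : ∀ i ∈ M.K, ∫ ω, ∑ j ∈ M.Kᶜ,
        (C ∩ {ω | (M.graph ω).Adj i j}).indicator (fun _ => (1 : ℝ)) ω ∂P
          = (n - M.k) * (P.real C * M.q) := by
      intro i hi
      rw [integral_finsetSum _ fun j _ => hint1 i j]
      have h4 : ∀ j ∈ M.Kᶜ,
          ∫ ω, (C ∩ {ω | (M.graph ω).Adj i j}).indicator (fun _ => (1 : ℝ)) ω ∂P
            = P.real C * M.q := by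
        intro j hj
        rw [integral_indicator_const _ (hmeas i j), smul_eq_mul, mul_one,
          M.measureReal_clusterConnected_inter_adj hi (Finset.mem_compl.1 hj)]
      rw [Finset.sum_congr rfl h4, Finset.sum_const, Finset.card_compl, Fintype.card_fin,
        nsmul_eq_mul, Nat.cast_sub (by simpa using Finset.card_le_univ M.K)]
      rfl
    rw [Finset.sum_congr rfl h3, Finset.sum_const, nsmul_eq_mul]
    unfold k
    ring
  rw [h2] at h1
  refine le_trans (mul_le_mul_of_nonneg_left (measureReal_mono ?_ (measure_ne_top _ _)) ha.le) h1
  rintro ω ⟨hω, hle⟩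
  refine hle.trans (le_of_eq (Finset.sum_congr rfl fun i _ => Finset.sum_congr rfl fun j _ => ?_))
  have hω' : ω ∈ C := hω
  simp [Set.indicator_apply, hω']

/-- Failure probability of the recovery of a connected cluster, for a noise radius `ρ` that is
small with respect to both `μ̂` and `γ^(-1/2)`. -/
theorem measureReal_connected_not_recovers_le [IsProbabilityMeasure P]
    (M : ContextualLocalModel n P) {γ β ρ : ℝ} (hγ : 0 ≤ γ) (hβ : 0 < β) (hρ : 0 ≤ ρ)
    (hσ : 0 < M.sigmaHat) (hk : 2 ≤ M.K.card) (hγρ : γ * (2 * ρ) ^ 2 ≤ Real.log 2)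
    (hρμ : 4 * ρ ≤ M.muHat) :
    P.real {ω | M.ClusterConnected ω ∧ ¬ M.Recovers γ β ω}
      ≤ (n * Real.exp (2 * ∑ l, M.sigma l ^ 2 / M.sigmaHat ^ 2 - ρ ^ 2 / (4 * M.sigmaHat ^ 2))
          + 2 * M.k ^ 2 * (1 + 1 / β) * (M.q * (n - M.k)) * Real.exp (-(γ * M.muHat ^ 2 / 4)))
        * P.real {ω | M.ClusterConnected ω} := by
  classical
  have hk2 : (2 : ℝ) ≤ M.k := by unfold k; exact_mod_cast hk
  set C := {ω | M.ClusterConnected ω} with hC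
  set E := Real.exp (-(γ * M.muHat ^ 2 / 4)) with hE
  have hE0 : 0 < E := Real.exp_pos _
  -- The number of boundary edges of weight `E` at which `k (1 + β)` times the cut weight reaches `β
  -- / 2`.
  set a := β / (2 * M.k * (1 + β) * E) with ha
  have hβ1 : 0 < 1 + β := by linarith
  have hkpos : 0 < M.k := by linarith
  have ha0 : 0 < a := by positivity
  set B := {ω | M.ClusterConnected ω ∧
        a ≤ ∑ i ∈ M.K, ∑ j ∈ M.Kᶜ, if (M.graph ω).Adj i j then (1 : ℝ) else 0} with hB
  have hsub : {ω | M.ClusterConnected ω ∧ ¬ M.Recovers γ β ω}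
      ⊆ (⋃ i : Fin n, C ∩ {ω | ρ ^ 2 ≤ ∑ l, M.Z i l ω ^ 2}) ∪ B := by
    rintro ω ⟨hconn, hrec⟩
    by_contra hω
    simp only [Set.mem_union, Set.mem_iUnion, not_or, not_exists] at hω
    obtain ⟨hZ', hcut'⟩ := hω
    have hZ : ∀ i, ∑ l, M.Z i l ω ^ 2 < ρ ^ 2 := fun i => by
      by_contra! h
      exact hZ' i ⟨hconn, h⟩
    have hcut : ∑ i ∈ M.K, ∑ j ∈ M.Kᶜ, (if (M.graph ω).Adj i j then (1 : ℝ) else 0) < a := by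
      by_contra! h
      exact hcut' ⟨hconn, h⟩
    refine hrec (M.recovers_of_connected hβ hconn hk
      (fun i hi j hj hij => M.half_le_weights hγ hρ hZ hγρ hi hj hij) ?_)
    have hW : ∑ i ∈ M.K, ∑ j ∈ M.Kᶜ, M.weights γ ω i j
        ≤ (∑ i ∈ M.K, ∑ j ∈ M.Kᶜ, if (M.graph ω).Adj i j then (1 : ℝ) else 0) * E := by
      rw [Finset.sum_mul]
      refine Finset.sum_le_sum fun i hi => ?_
      rw [Finset.sum_mul]
      exact Finset.sum_le_sum fun j hj =>
        M.weights_le_of_across hγ hρ hZ hρμ hi (Finset.mem_compl.1 hj)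
    have hlt : ∑ i ∈ M.K, ∑ j ∈ M.Kᶜ, M.weights γ ω i j < a * E :=
      hW.trans_lt (mul_lt_mul_of_pos_right hcut hE0)
    calc M.K.card * (1 + β) * ∑ i ∈ M.K, ∑ j ∈ M.Kᶜ, M.weights γ ω i j
        < M.k * (1 + β) * (a * E) := mul_lt_mul_of_pos_left hlt (by positivity)
      _ = β * (1 / 2) := by rw [ha]; field_simp
  have hnoise : P.real (⋃ i : Fin n, C ∩ {ω | ρ ^ 2 ≤ ∑ l, M.Z i l ω ^ 2})
      ≤ n * Real.exp (2 * ∑ l, M.sigma l ^ 2 / M.sigmaHat ^ 2 - ρ ^ 2 / (4 * M.sigmaHat ^ 2))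
        * P.real C := by
    calc _ ≤ ∑ i : Fin n, P.real (C ∩ {ω | ρ ^ 2 ≤ ∑ l, M.Z i l ω ^ 2}) :=
          measureReal_iUnion_fintype_le _
      _ ≤ ∑ _i : Fin n, P.real C * Real.exp (2 * ∑ l, M.sigma l ^ 2 / M.sigmaHat ^ 2
            - ρ ^ 2 / (4 * M.sigmaHat ^ 2)) := by
          refine Finset.sum_le_sum fun i _ => ?_
          rw [hC, M.measureReal_clusterConnected_inter_noise]
          exact mul_le_mul_of_nonneg_left (M.measureReal_le_sum_Z_sq hσ i _) measureReal_nonneg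
      _ = _ := by simp; ring
  have hcutP : P.real B ≤ 2 * M.k ^ 2 * (1 + 1 / β) * (M.q * (n - M.k)) * E * P.real C := by
    have h1 := M.mul_measureReal_clusterConnected_inter_le a
    rw [← hB, ← hC, mul_comm, ← le_div_iff₀ ha0] at h1
    refine h1.trans (le_of_eq ?_)
    rw [ha]; field_simp; ring
  calc _ ≤ P.real ((⋃ i : Fin n, C ∩ {ω | ρ ^ 2 ≤ ∑ l, M.Z i l ω ^ 2}) ∪ B) :=
        measureReal_mono hsub (measure_ne_top _ _)
    _ ≤ _ := measureReal_union_le _ _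
    _ ≤ _ := by rw [add_mul]; exact add_le_add hnoise hcutP

theorem recovers_of_card_eq_zero (M : ContextualLocalModel n P) (γ β : ℝ) (ω : Ω)
    (h : M.K.card = 0) : M.Recovers γ β ω := by
  intro s hs
  rw [Finset.card_eq_zero.1 h] at hs
  simp at hs

end ContextualLocalModel

/-! ### Asymptotics. -/

theorem Real.le_exp_posLog (x : ℝ) : x ≤ Real.exp (Real.posLog x) := by
  rcases le_or_gt x 0 with hx | hx
  · exact hx.trans (Real.exp_pos _).le
  · calc x = Real.exp (Real.log x) := (Real.exp_log hx).symm
      _ ≤ _ := Real.exp_le_exp.2 (le_max_right _ _)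

/-- This puts the Markov prefactor in the form to be compared with `λ`. The factor `2` comes from
`k²`; doubling the other two terms is harmless because they are nonnegative. -/
theorem two_mul_sq_mul_le_exp {k β x : ℝ} (hk : 0 < k) (hx : 0 ≤ x) :
    2 * k ^ 2 * (1 + 1 / β) * x
      ≤ Real.exp (Real.log 4 + 2 * (Real.log k + Real.posLog (1 / β) + Real.posLog x)) := by
  have h1 : 1 + 1 / β ≤ 2 * Real.exp (Real.posLog (1 / β)) := by
    linarith [Real.le_exp_posLog (1 / β), Real.one_le_exp (Real.posLog_nonneg (x := 1 / β))]
  have hP := Real.posLog_nonneg (x := 1 / β)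
  have hQ := Real.posLog_nonneg (x := x)
  calc 2 * k ^ 2 * (1 + 1 / β) * x
      ≤ 2 * k ^ 2 * (2 * Real.exp (Real.posLog (1 / β))) * Real.exp (Real.posLog x) := by
        gcongr
        exact Real.le_exp_posLog x
    _ = Real.exp (Real.log 4 + 2 * Real.log k + Real.posLog (1 / β) + Real.posLog x) := by
        rw [Real.exp_add, Real.exp_add, Real.exp_add, Real.exp_log (by norm_num), two_mul
          (Real.log k), Real.exp_add, Real.exp_log hk]
        ring
    _ ≤ _ := Real.exp_le_exp.2 (by linarith)

section Asymptotic

variable {Ω : ℕ → Type*} [∀ n, MeasurableSpace (Ω n)] {P : ∀ n, Measure (Ω n)}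
  [∀ n, IsProbabilityMeasure (P n)] {M : ∀ n, ContextualLocalModel n (P n)} {lam γ β : ℕ → ℝ}

/-- The failure probability given connectivity of clusters with at least two nodes vanishes. -/
theorem exists_tendsto_connected_not_recovers_le
    (hassum : SignalAssumption M lam) (hγ0 : ∀ n, 0 ≤ γ n)
    (hγσ : (fun n => γ n * (M n).sigmaHat ^ 2) =o[atTop] fun n => (Real.log n)⁻¹)
    (hγμ : lam =o[atTop] fun n => γ n * (M n).muHat ^ 2) (hβ : ∀ n, 0 < β n)
    {c : ℝ} (hc : 0 < c)
    (hlam : ∀ᶠ n in atTop, 2 ≤ (M n).K.card →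
      c * (Real.log (M n).k + Real.posLog (1 / β n) + Real.posLog ((M n).q * (n - (M n).k)))
        ≤ lam n) :
    ∃ r : ℕ → ℝ, Tendsto r atTop (𝓝 0) ∧ (∀ n, 0 ≤ r n) ∧ ∀ᶠ n in atTop, 2 ≤ (M n).K.card →
      (P n).real {ω | (M n).ClusterConnected ω ∧ ¬ (M n).Recovers (γ n) (β n) ω}
        ≤ r n * (P n).real {ω | (M n).ClusterConnected ω} := by
  obtain ⟨⟨c₁, hc₁, hlam₁⟩, hmu, hsig⟩ := hassum
  obtain ⟨C₃, hC₃, hsum⟩ := hsig.exists_pos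
  rw [isBigOWith_iff] at hsum
  have hmunn : ∀ n, 0 ≤ γ n * (M n).muHat ^ 2 := fun n => mul_nonneg (hγ0 n) (sq_nonneg _)
  have hlamle : ∀ D : ℝ, 0 < D → ∀ᶠ n in atTop, D * lam n ≤ γ n * (M n).muHat ^ 2 := by
    intro D hD
    filter_upwards [hγμ.bound (inv_pos.2 hD)] with n hn
    rw [Real.norm_of_nonneg (hmunn n)] at hn
    have := (le_abs_self (lam n)).trans hn
    calc D * lam n ≤ D * (D⁻¹ * (γ n * (M n).muHat ^ 2)) := mul_le_mul_of_nonneg_left this hD.le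
      _ = _ := by field_simp
  have hinf : Tendsto (fun n => γ n * (M n).muHat ^ 2) atTop atTop := by
    refine tendsto_atTop.2 fun b => ?_
    filter_upwards [hlamle ((|b| + 1) / c₁) (by positivity), hlam₁] with n h1 h2
    have h3 : |b| + 1 ≤ (|b| + 1) / c₁ * lam n := by
      calc |b| + 1 = (|b| + 1) / c₁ * (c₁ * 1) := by field_simp
        _ ≤ _ := mul_le_mul_of_nonneg_left h2 (by positivity)
    linarith [le_abs_self b]
  -- Then `ρ² / (4 σ̂²) = (2 C₃ + 2) log n`: the part `2 C₃ log n` cancels the exponential moment,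
  -- and `2 log n` leaves `1/n` after the union bound over nodes.
  set A := 4 * (2 * C₃ + 2) with hA
  have hA0 : 0 < A := by positivity
  have hlog2 : 0 < Real.log 2 := Real.log_pos (by norm_num)
  -- `D λ` dominates the logarithm of the Markov prefactor. Asking for `8 D λ ≤ γ μ̂²` spends half
  -- of the exponent `γ μ̂² / 4` on it.
  set D := Real.log 4 / c₁ + 2 / c with hD
  have hD0 : 0 < D := add_pos (div_pos (Real.log_pos (by norm_num)) hc₁) (by positivity)
  have hs : 0 < 4 * Real.sqrt (A / c₁) := by positivity
  refine ⟨fun n => (n : ℝ)⁻¹ + Real.exp (-(γ n * (M n).muHat ^ 2 / 8)), ?_, fun n => by positivity,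
    ?_⟩
  · rw [← add_zero (0 : ℝ)]
    refine tendsto_inv_atTop_nhds_zero_nat.add
      (Real.tendsto_exp_neg_atTop_nhds_zero.comp (hinf.atTop_div_const (by norm_num)))
  · filter_upwards [hlam, hlam₁, hsum, hlamle 1 one_pos, hlamle (8 * D) (by positivity),
      hγσ.bound (show 0 < Real.log 2 / (4 * A) by positivity), hmu.bound (inv_pos.2 hs),
      eventually_ge_atTop 2] with n hlam hlam₁ hsum hμ1 hμD hγσ hmu hn hk
    have hn2 : (2 : ℝ) ≤ n := by exact_mod_cast hn
    have hlogn : 0 < Real.log n := Real.log_pos (by linarith)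
    have hlam0 : 0 < lam n := by linarith
    -- `γ μ̂² ≥ λ > 0` excludes `μ̂ = 0`, and with it the degenerate value `σ̂ = 0`.
    have hμ0 : (M n).muHat ≠ 0 := by
      intro h
      rw [h] at hμ1
      norm_num at hμ1
      linarith
    have hσ := (M n).sigmaHat_pos_of_muHat_ne_zero hμ0
    set ρ := (M n).sigmaHat * Real.sqrt (A * Real.log n) with hρ
    have hρ0 : 0 ≤ ρ := by positivity
    have hρ2 : ρ ^ 2 = (M n).sigmaHat ^ 2 * (A * Real.log n) := by
      rw [hρ, mul_pow, Real.sq_sqrt (by positivity)]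
    have hγρ : γ n * (2 * ρ) ^ 2 ≤ Real.log 2 := by
      rw [Real.norm_of_nonneg (mul_nonneg (hγ0 n) (sq_nonneg _)),
        Real.norm_of_nonneg (by positivity)] at hγσ
      calc γ n * (2 * ρ) ^ 2 = (γ n * (M n).sigmaHat ^ 2) * (4 * A * Real.log n) := by
            rw [mul_pow, hρ2]; ring
        _ ≤ Real.log 2 / (4 * A) * (Real.log n)⁻¹ * (4 * A * Real.log n) :=
            mul_le_mul_of_nonneg_right hγσ (by positivity)
        _ = Real.log 2 := by field_simp
    have hρμ : 4 * ρ ≤ (M n).muHat := by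
      rw [Real.norm_of_nonneg (M n).muHat_nonneg, Real.norm_of_nonneg (by positivity)] at hmu
      have h1 : Real.sqrt (A * Real.log n)
          ≤ Real.sqrt (A / c₁) * Real.sqrt (lam n * Real.log n) := by
        rw [← Real.sqrt_mul (by positivity)]
        refine Real.sqrt_le_sqrt ?_
        calc A * Real.log n = A / c₁ * ((c₁ * 1) * Real.log n) := by field_simp
          _ ≤ _ := by gcongr
      calc 4 * ρ ≤ 4 * ((M n).sigmaHat
            * (Real.sqrt (A / c₁) * Real.sqrt (lam n * Real.log n))) := by
            rw [hρ]; gcongr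
        _ = 4 * Real.sqrt (A / c₁) * ((M n).sigmaHat * Real.sqrt (lam n * Real.log n)) := by ring
        _ ≤ 4 * Real.sqrt (A / c₁) * ((4 * Real.sqrt (A / c₁))⁻¹ * (M n).muHat) :=
            mul_le_mul_of_nonneg_left hmu hs.le
        _ = (M n).muHat := by field_simp
    refine ((M n).measureReal_connected_not_recovers_le (hγ0 n) (hβ n) hρ0 hσ hk hγρ hρμ).trans
      (mul_le_mul_of_nonneg_right (add_le_add ?_ ?_) measureReal_nonneg)
    · have h1 : ∑ l, (M n).sigma l ^ 2 / (M n).sigmaHat ^ 2 ≤ C₃ * Real.log n := by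
        have := (le_abs_self _).trans hsum
        rwa [Real.norm_of_nonneg hlogn.le] at this
      have h2 : ρ ^ 2 / (4 * (M n).sigmaHat ^ 2) = (2 * C₃ + 2) * Real.log n := by
        rw [hρ2, hA]; field_simp
      have h3 : Real.exp (2 * ∑ l, (M n).sigma l ^ 2 / (M n).sigmaHat ^ 2
          - ρ ^ 2 / (4 * (M n).sigmaHat ^ 2)) ≤ ((n : ℝ)⁻¹) ^ 2 := by
        have h4 : ((n : ℝ)⁻¹) ^ 2 = Real.exp (-(2 * Real.log n)) := by
          rw [two_mul, Real.exp_neg, Real.exp_add, Real.exp_log (by linarith), ← pow_two, inv_pow]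
        rw [h4]
        exact Real.exp_le_exp.2 (by linarith)
      calc (n : ℝ) * _ ≤ n * ((n : ℝ)⁻¹) ^ 2 := mul_le_mul_of_nonneg_left h3 (by linarith)
        _ = (n : ℝ)⁻¹ := by field_simp
    · have hk2 : (2 : ℝ) ≤ (M n).k := by unfold ContextualLocalModel.k; exact_mod_cast hk
      have hkn : (M n).k ≤ n := by
        unfold ContextualLocalModel.k
        exact_mod_cast (Finset.card_le_univ (M n).K).trans_eq (Fintype.card_fin n)
      have h1 := two_mul_sq_mul_le_exp (k := (M n).k) (x := (M n).q * (n - (M n).k))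
        (β := β n) (by linarith) (mul_nonneg (M n).q_mem.1 (by linarith))
      refine (mul_le_mul_of_nonneg_right h1 (Real.exp_pos _).le).trans ?_
      rw [← Real.exp_add]
      refine Real.exp_le_exp.2 ?_
      have h2 : Real.log 4 ≤ Real.log 4 / c₁ * lam n := by
        have h4 : 0 < Real.log 4 := Real.log_pos (by norm_num)
        rw [div_mul_eq_mul_div, le_div_iff₀ hc₁]
        nlinarith
      have h3 := (le_div_iff₀' hc).2 (hlam hk)
      have h4 : 2 / c * lam n = 2 * (lam n / c) := by ring
      have h5 : D * lam n = Real.log 4 / c₁ * lam n + 2 / c * lam n := by rw [hD]; ring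
      linarith

end Asymptotic

/-! ### The two claims. -/

theorem theorem1 {Ω : ℕ → Type*} [∀ n, MeasurableSpace (Ω n)]
    (P : ∀ n, Measure (Ω n)) [∀ n, IsProbabilityMeasure (P n)]
    (M : ∀ n, ContextualLocalModel n (P n))
    (lam γ β : ℕ → ℝ)
    (hassum : SignalAssumption M lam)
    (hγ0 : ∀ n, 0 ≤ γ n)
    (hγσ : (fun n => γ n * (M n).sigmaHat ^ 2) =o[atTop] fun n => (Real.log n)⁻¹)
    (hγμ : lam =o[atTop] fun n => γ n * (M n).muHat ^ 2)
    (hβ : ∀ n, 0 < β n) :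
    (IsBigOmega lam (fun n => Real.log (M n).k + Real.posLog (1 / β n)
          + Real.posLog ((M n).q * (n - (M n).k))) →
      ∃ r : ℕ → ℝ, Tendsto r atTop (𝓝 0) ∧ ∀ n,
        (P n).real {ω | (M n).ClusterConnected ω ∧ ¬ (M n).Recovers (γ n) (β n) ω}
          ≤ (r n + (M n).k ^ (-(1 / 3) : ℝ)) * (P n).real {ω | (M n).ClusterConnected ω}) ∧
    (∀ δ ε : ℕ → ℝ, (∀ n, 0 < δ n ∧ δ n < 1) → (∀ n, 0 < ε n) →
      (∀ᶠ n in atTop,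
        (4 + ε n) / δ n ^ 2 * (Real.log (M n).k / ((M n).k - 1)) ≤ (M n).p) →
      IsBigOmega lam (fun n => Real.log (M n).k + Real.posLog (1 / β n)
          + Real.posLog ((M n).q * (n - (M n).k) / ((M n).p * ((M n).k - 1)))
          + Real.log (1 / (1 - δ n))) →
      ∃ r : ℕ → ℝ, Tendsto r atTop (𝓝 0) ∧ ∀ n,
        (P n).real {ω | ¬ (M n).Recovers (γ n) (β n) ω}
          ≤ r n + (M n).k ^ (-(1 / 3) : ℝ)
            + Real.exp 1 * (M n).k ^ (-(ε n / 2))) := by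
  have hk0 : ∀ n, 0 ≤ (M n).k := fun n => Nat.cast_nonneg _
  -- The bounds must hold for every `n`; setting the error to `1` for small `n` makes them trivial
  -- there.
  have htrunc : ∀ (r : ℕ → ℝ) (N : ℕ), Tendsto r atTop (𝓝 0) →
      Tendsto (fun n => if N ≤ n then r n else 1) atTop (𝓝 0) := fun r N hr =>
    hr.congr' (by filter_upwards [eventually_ge_atTop N] with n hn using by simp [hn])
  -- An isolated singleton cluster has `deg = 0` and is not recovered; for `k = 1` the term
  -- `k^(-1/3) = 1` makes the bound trivial.
  have hone : ∀ n, (M n).K.card = 1 → (M n).k ^ (-(1 / 3) : ℝ) = 1 := fun n h => by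
    simp [ContextualLocalModel.k, h]
  constructor
  · rintro ⟨c, hc, hlam⟩
    obtain ⟨r, hr, hr0, hev⟩ := exists_tendsto_connected_not_recovers_le hassum hγ0 hγσ hγμ hβ hc
      (hlam.mono fun n h _ => h)
    obtain ⟨N, hN⟩ := eventually_atTop.1 hev
    refine ⟨_, htrunc r N hr, fun n => ?_⟩
    have hkp := Real.rpow_nonneg (hk0 n) (-(1 / 3) : ℝ)
    have hle : (P n).real {ω | (M n).ClusterConnected ω ∧ ¬ (M n).Recovers (γ n) (β n) ω}
        ≤ (P n).real {ω | (M n).ClusterConnected ω} :=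
      measureReal_mono (fun ω h => h.1) (measure_ne_top _ _)
    have hP0 : 0 ≤ (P n).real {ω | (M n).ClusterConnected ω} := measureReal_nonneg
    split_ifs with hn
    · have hrn := hr0 n
      rcases lt_or_ge 1 (M n).K.card with hk | hk
      · refine (hN n hn hk).trans (mul_le_mul_of_nonneg_right (by linarith) hP0)
      · rcases Nat.le_one_iff_eq_zero_or_eq_one.1 hk with hk | hk
        · refine le_trans (le_of_eq ?_) (mul_nonneg (add_nonneg hrn hkp) hP0)
          simp [(M n).recovers_of_card_eq_zero (γ n) (β n) _ hk]
        · rw [hone n hk]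
          exact hle.trans (le_mul_of_one_le_left hP0 (by linarith))
    · exact hle.trans (le_mul_of_one_le_left hP0 (by linarith))
  · rintro δ ε hδ hε hp ⟨c, hc, hlam⟩
    have hpk : ∀ᶠ n in atTop, 2 ≤ (M n).K.card →
        (4 + ε n) * Real.log (M n).k ≤ (M n).p * ((M n).k - 1) := by
      filter_upwards [hp] with n hp hk
      have hk2 : (2 : ℝ) ≤ (M n).k := by unfold ContextualLocalModel.k; exact_mod_cast hk
      have hlog : 0 < Real.log (M n).k := Real.log_pos (by linarith)
      have hk1 : 0 < (M n).k - 1 := by linarith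
      have hεn := hε n
      rw [← div_le_iff₀ hk1, mul_div_assoc]
      refine le_trans (mul_le_mul_of_nonneg_right ?_ (by positivity)) hp
      -- As `δ < 1`, dividing by `δ²` only strengthens the condition on `p`.
      refine le_div_self (by linarith) (by have := (hδ n).1; positivity) ?_
      exact pow_le_one₀ (hδ n).1.le (hδ n).2.le
    -- Replacing `q(n-k) / (p(k-1))` by `q(n-k)` costs at most `log k`, hence the constant `c / 2`.
    have hlam' : ∀ᶠ n in atTop, 2 ≤ (M n).K.card →
        c / 2 * (Real.log (M n).k + Real.posLog (1 / β n)
          + Real.posLog ((M n).q * (n - (M n).k))) ≤ lam n := by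
      filter_upwards [hlam, hpk] with n hlam hpk hk
      have hk2 : (2 : ℝ) ≤ (M n).k := by unfold ContextualLocalModel.k; exact_mod_cast hk
      have hlog : 0 < Real.log (M n).k := Real.log_pos (by linarith)
      have hpk0 : 0 < (M n).p * ((M n).k - 1) :=
        (mul_pos (by linarith [hε n]) hlog).trans_le (hpk hk)
      have hpkle : (M n).p * ((M n).k - 1) ≤ (M n).k := by
        nlinarith [(M n).p_mem.2]
      have h1 : Real.posLog ((M n).q * (n - (M n).k))
          ≤ Real.posLog ((M n).q * (n - (M n).k) / ((M n).p * ((M n).k - 1)))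
            + Real.log (M n).k := by
        calc _ = Real.posLog ((M n).q * (n - (M n).k) / ((M n).p * ((M n).k - 1))
              * ((M n).p * ((M n).k - 1))) := by rw [div_mul_cancel₀ _ hpk0.ne']
          _ ≤ _ := Real.posLog_mul
          _ ≤ _ := by
            refine add_le_add_right ?_ _
            refine (Real.posLog_le_posLog hpk0.le hpkle).trans (le_of_eq ?_)
            exact Real.posLog_eq_log (by rw [abs_of_pos] <;> linarith)
      have h2 : 0 ≤ Real.log (1 / (1 - δ n)) := by
        refine Real.log_nonneg ?_
        rw [le_div_iff₀ (by linarith [(hδ n).2])]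
        linarith [(hδ n).1]
      have h3 := Real.posLog_nonneg (x := 1 / β n)
      have h4 := Real.posLog_nonneg
        (x := (M n).q * (n - (M n).k) / ((M n).p * ((M n).k - 1)))
      refine le_trans ?_ hlam
      rw [div_mul_eq_mul_div, mul_div_assoc]
      exact mul_le_mul_of_nonneg_left (by linarith) hc.le
    obtain ⟨r, hr, hr0, hev⟩ := exists_tendsto_connected_not_recovers_le hassum hγ0 hγσ hγμ hβ
      (half_pos hc) hlam'
    obtain ⟨N, hN⟩ := eventually_atTop.1 (hev.and hpk)
    refine ⟨_, htrunc r N hr, fun n => ?_⟩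
    have hkp := Real.rpow_nonneg (hk0 n) (-(1 / 3) : ℝ)
    have hkε : 0 ≤ Real.exp 1 * (M n).k ^ (-(ε n / 2)) :=
      mul_nonneg (Real.exp_pos 1).le (Real.rpow_nonneg (hk0 n) _)
    have hle : (P n).real {ω | ¬ (M n).Recovers (γ n) (β n) ω} ≤ 1 := measureReal_le_one
    split_ifs with hn
    · have hrn := hr0 n
      rcases lt_or_ge 1 (M n).K.card with hk | hk
      · have h1 := (hN n hn).1 hk
        have h2 := (M n).measureReal_not_clusterConnected_le (hε n) hk ((hN n hn).2 hk)
        have h3 : (P n).real {ω | (M n).ClusterConnected ω} ≤ 1 := measureReal_le_one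
        have h4 : (P n).real {ω | ¬ (M n).Recovers (γ n) (β n) ω}
            ≤ (P n).real {ω | (M n).ClusterConnected ω ∧ ¬ (M n).Recovers (γ n) (β n) ω}
              + (P n).real {ω | ¬ (M n).ClusterConnected ω} := by
          refine (measureReal_mono (fun ω hω => ?_) (measure_ne_top _ _)).trans
            (measureReal_union_le _ _)
          by_cases h : (M n).ClusterConnected ω
          · exact Or.inl ⟨h, hω⟩
          · exact Or.inr h
        have h5 := mul_le_of_le_one_right hrn h3
        linarith
      · rcases Nat.le_one_iff_eq_zero_or_eq_one.1 hk with hk | hk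
        · refine le_trans (le_of_eq ?_) (add_nonneg (add_nonneg hrn hkp) hkε)
          simp [(M n).recovers_of_card_eq_zero (γ n) (β n) _ hk]
        · rw [hone n hk]
          linarith
    · linarith
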